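/- Let $\mathbb K\in\{\mathbb R,\mathbb C\}$, let $Q_+=\,]0,\infty[^d$, and let $\Omega\subset\mathbb R^d$ be a non-empty open set that is relatively compact in $Q_+$, i.e. $\overline{\Omega}$ is compact and $\overline{\Omega}\subset Q_+$. Let $\mathcal D'(\Omega)$ be the space of $\mathbb K$-valued distributions on $\Omega$ with its usual (strong) topology. A Hadamard operator on $\mathcal D'(\Omega)$ is a continuous linear operator $L:\mathcal D'(\Omega)\to\mathcal D'(\Omega)$ that admits all monomials as eigenvectors: for every $\alpha\in\mathbb N_0^d$ there is $m_\alpha\in\mathbb K$ with $L(x^\alpha)=m_\alpha x^\alpha$ (where $x^\alpha$ is regarded as a distribution on $\Omega$). Then every Hadamard operator $L$ on $\mathcal D'(\Omega)$ is an Euler operator, that is, there is a polynomial $P(X)=\sum_\alpha c_\alpha X^\alpha\in\mathbb K[X_1,\dots,X_d]$ such that $$L=P(\theta)=\sum_\alpha c_\alpha\,\theta^\alpha,\qquad \theta^\alpha=\theta_1^{\alpha_1}\cdots\theta_d^{\alpha_d},\qquad \theta_j=x_j\frac{\partial}{\partial x_j}.$$ -/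

import Mathlib

open TopologicalSpace MeasureTheory
open scoped Distributions LineDeriv

noncomputable section

namespace Hadamard

variable {d : ℕ}

/-- The open positive orthant `]0, ∞[^d` of `ℝ^d`. -/
def posOrthant (d : ℕ) : Set (Fin d → ℝ) := {x | ∀ j, 0 < x j}

/-- `A` is relatively compact in `B`: the closure of `A` is compact and contained in `B`. -/
def RelativelyCompactIn (A B : Set (Fin d → ℝ)) : Prop :=
  IsCompact (closure A) ∧ closure A ⊆ B

/-- The multiplication `φ ↦ x_j φ` of test functions on `Ω` by the `j`-th coordinate. -/
def coordMulTest (Ω : Opens (Fin d → ℝ)) (j : Fin d) : 𝓓(Ω, ℝ) →L[ℝ] 𝓓(Ω, ℝ) :=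
  TestFunction.limitCLM ℝ
    (fun φ => (⟨fun x => φ x * x j, φ.contDiff.mul (contDiff_apply ℝ ℝ j),
      φ.hasCompactSupport.mul_right,
      (closure_mono (Function.support_mul_subset_left _ _)).trans φ.tsupport_subset⟩ : 𝓓(Ω, ℝ)))
    (fun _ hK => TestFunction.ofSupportedInCLM ℝ hK ∘L
      ContDiffMapSupportedIn.bilinLeftCLM (ContinuousLinearMap.mul ℝ ℝ)
        (g := fun x : Fin d → ℝ => x j) (contDiff_apply ℝ ℝ j))
    (fun _ _ _ => rfl)

theorem coordMulTest_apply (Ω : Opens (Fin d → ℝ)) (j : Fin d) (φ : 𝓓(Ω, ℝ)) (x : Fin d → ℝ) :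
    coordMulTest Ω j φ x = φ x * x j := rfl

variable (𝕜 : Type*) [RCLike 𝕜] (Ω : Opens (Fin d → ℝ))

/-- The partial derivative `∂/∂x_j` on distributions, `(∂_j S)(φ) = -S(∂_j φ)`. -/
def partialDeriv (j : Fin d) : 𝓓'(Ω, 𝕜) →L[𝕜] 𝓓'(Ω, 𝕜) where
  toFun S := ∂_{(Pi.single j 1 : Fin d → ℝ)} S
  map_add' S T := map_add (Distribution.lineDerivCLM (Pi.single j 1 : Fin d → ℝ)) S T
  map_smul' c S := by
    ext φ
    simp
  cont := (Distribution.lineDerivCLM (Pi.single j 1 : Fin d → ℝ)).continuous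

/-- The multiplication of distributions by the `j`-th coordinate, `(x_j S)(φ) = S(x_j φ)`. -/
def coordMul (j : Fin d) : 𝓓'(Ω, 𝕜) →L[𝕜] 𝓓'(Ω, 𝕜) where
  toFun S := (coordMulTest Ω j).precompCompactConvergenceCLM 𝕜 S
  map_add' S T := map_add ((coordMulTest Ω j).precompCompactConvergenceCLM 𝕜) S T
  map_smul' _ _ := rfl
  cont := ((coordMulTest Ω j).precompCompactConvergenceCLM 𝕜).continuous

/-- The operator `θ_j = x_j ∂/∂x_j` on `𝓓'(Ω)`. -/
def theta (j : Fin d) : 𝓓'(Ω, 𝕜) →L[𝕜] 𝓓'(Ω, 𝕜) :=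
  coordMul 𝕜 Ω j ∘L partialDeriv 𝕜 Ω j

theorem theta_apply (j : Fin d) (S : 𝓓'(Ω, 𝕜)) (φ : 𝓓(Ω, ℝ)) :
    theta 𝕜 Ω j S φ = -S (∂_{(Pi.single j 1 : Fin d → ℝ)} (coordMulTest Ω j φ)) := rfl

/-- The composition `θ^α = θ_1^{α_1} ∘ ⋯ ∘ θ_d^{α_d}`; product and powers are those of the ring
of continuous linear operators. -/
def thetaPow (α : Fin d →₀ ℕ) : 𝓓'(Ω, 𝕜) →L[𝕜] 𝓓'(Ω, 𝕜) :=
  (List.ofFn fun j => theta 𝕜 Ω j ^ α j).prod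

variable {𝕜} in
/-- The operator `P(θ) = ∑_α c_α θ^α` for the polynomial `P = ∑_α c_α X^α`. -/
def polyTheta (P : MvPolynomial (Fin d) 𝕜) : 𝓓'(Ω, 𝕜) →L[𝕜] 𝓓'(Ω, 𝕜) :=
  ∑ α ∈ P.support, P.coeff α • thetaPow 𝕜 Ω α

/-- The monomial `x ↦ x^α` as a distribution on `Ω`, namely `φ ↦ ∫ φ(x) x^α dx`. -/
def monomialDist (α : Fin d →₀ ℕ) : 𝓓'(Ω, 𝕜) :=
  TestFunction.integralAgainstBilinCLM (ContinuousLinearMap.lsmul ℝ ℝ : ℝ →L[ℝ] 𝕜 →L[ℝ] 𝕜)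
    volume (fun x : Fin d → ℝ => ∏ j, (x j : 𝕜) ^ α j)

theorem monomialDist_apply (α : Fin d →₀ ℕ) (φ : 𝓓(Ω, ℝ)) :
    monomialDist 𝕜 Ω α φ = ∫ x, φ x • ∏ j, (x j : 𝕜) ^ α j := by
  have h : Continuous fun x : Fin d → ℝ => ∏ j, (x j : 𝕜) ^ α j := by fun_prop
  exact TestFunction.integralAgainstBilinCLM_eq_integral
    (h.locallyIntegrable.locallyIntegrableOn _)

variable {𝕜 Ω}

/-- A Hadamard operator: a continuous linear operator on `𝓓'(Ω)` that admits every monomial as an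
eigenvector. -/
def IsHadamardOperator (L : 𝓓'(Ω, 𝕜) →L[𝕜] 𝓓'(Ω, 𝕜)) : Prop :=
  ∀ α : Fin d →₀ ℕ, ∃ m : 𝕜, Module.End.HasEigenvector
    (L : 𝓓'(Ω, 𝕜) →ₗ[𝕜] 𝓓'(Ω, 𝕜)) m (monomialDist 𝕜 Ω α)

/-- An Euler operator: an operator of the form `P(θ)` with a polynomial `P`. -/
def IsEulerOperator (L : 𝓓'(Ω, 𝕜) →L[𝕜] 𝓓'(Ω, 𝕜)) : Prop :=
  ∃ P : MvPolynomial (Fin d) 𝕜, L = polyTheta Ω P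

end Hadamard

end

/-! Everything is read off from the transpose of `L`. The topology of `𝓓'(Ω)` is uniform convergence
on compact sets and closed convex hulls of compact sets of test functions are compact, so a
Mackey–Arens argument identifies the dual of `𝓓'(Ω)` with the test functions
(`Distribution.exists_testFunction_pair_forall_eq`). Hence `⟨L S, φ⟩ = ⟨S, Lᵗφ⟩` with a test
function `Lᵗφ`, whose value at `x` is `⟨L δ_x, φ⟩`.

The eigenvector condition says that `Lᵗ` multiplies the `α`-th moment by `m_α`. A compactly
supported continuous function is determined by its moments (Weierstrass), so `Lᵗ` commutes with
every dilation for which both test functions live on `Ω`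
(`IsHadamardOperator.transpose_comp_dilation`). Compactness of the closure of `Ω` in the orthant
then makes `Lᵗ` local: if `x ≠ y`, some dilation keeps `y` in `Ω` but pushes `x` out of it, where
`Lᵗ` of any test function vanishes (`IsHadamardOperator.exists_nhds_transpose_eq_zero`).

So `L δ_a` is supported at `a` and depends on a finite jet there. Since no `a_j` vanishes, that jet
is controlled by the transposes of the `θ^α`, and `L δ_a` is a linear combination of them at `a`.
These transposes also commute with dilations, which carry `a` to every other point of `Ω` with the
same coefficients; these are the coefficients of `P`. -/

noncomputable section

open Set Filter Topology
open scoped BoundedContinuousFunction ContDiff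

/-! ### Completeness of `𝓓_K`. -/

namespace ContDiffMapSupportedIn

variable {E F : Type*} [NormedAddCommGroup E] [NormedSpace ℝ E]
  [NormedAddCommGroup F] [NormedSpace ℝ F] {K : Compacts E}

/-- The jets of the elements of `𝓓_K` form a closed set of sequences of bounded functions. -/
theorem isClosed_range_pi_structureMapCLM :
    IsClosed (range (ContinuousLinearMap.pi (structureMapCLM ℝ ⊤) :
      𝓓_{K}(E, F) →L[ℝ] Π i, E →ᵇ (E [×i]→L[ℝ] F))) := by
  refine IsSeqClosed.isClosed fun u g hu hg => ?_
  choose f hf using hu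
  have hu' : ∀ n i x, u n i x = iteratedFDeriv ℝ i (f n) x := fun n i x => by
    rw [← hf n]
    simp
  have hunif : ∀ i, TendstoUniformly (fun n x => iteratedFDeriv ℝ i (f n) x) (g i) atTop := by
    intro i
    have : TendstoUniformly (fun n x => u n i x) (g i) atTop :=
      BoundedContinuousFunction.tendsto_iff_tendstoUniformly.1 ((tendsto_pi_nhds.1 hg) i)
    simpa only [hu'] using this
  -- Uniform limits commute with differentiation, so the limits `g i` are the successive derivatives
  -- of `g 0`.
  have hT : HasFTaylorSeriesUpTo (⊤ : ℕ∞) (fun x => (g 0 x).curry0) (fun x i => g i x) := by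
    refine ⟨fun x => rfl, fun i _ x => ?_, fun i _ => (g i).continuous⟩
    have hd : ∀ n x, HasFDerivAt (iteratedFDeriv ℝ i (f n))
        (iteratedFDeriv ℝ (i + 1) (f n) x).curryLeft x := by
      intro n x
      have h := (f n).contDiff.ftaylorSeries.fderiv i (by exact_mod_cast WithTop.coe_lt_top _) x
      exact h
    have hcl : TendstoUniformly (fun n x => (iteratedFDeriv ℝ (i + 1) (f n) x).curryLeft)
        (fun x => (g (i + 1) x).curryLeft) atTop :=
      (continuousMultilinearCurryLeftEquiv ℝ (fun _ : Fin (i + 1) => E) F).isometry.uniformContinuous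
        |>.comp_tendstoUniformly (hunif (i + 1))
    exact hasFDerivAt_of_tendstoUniformly hcl hd
      (fun x => (hunif i).tendsto_at x) x
  have hzero : EqOn (fun x => (g 0 x).curry0) 0 (K : Set E)ᶜ := by
    intro x hx
    have h1 := (hunif 0).tendsto_at x
    have h2 : g 0 x = 0 := by
      refine tendsto_nhds_unique h1 (tendsto_const_nhds.congr fun n => ?_)
      exact ((f n).iteratedFDeriv_zero_on_compl hx).symm
    simp [h2]
  refine ⟨⟨fun x => (g 0 x).curry0, hT.contDiff, hzero⟩, ?_⟩
  ext i x : 2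
  have := hT.eq_iteratedFDeriv (m := i) (by exact_mod_cast le_top) x
  simp only [ContinuousLinearMap.coe_pi', structureMapCLM_apply, le_top, if_true]
  exact this.symm

instance completeSpace [CompleteSpace F] : CompleteSpace 𝓓_{K}(E, F) :=
  (isUniformEmbedding_pi_structureMapCLM (n := ⊤) ℝ).isUniformInducing.completeSpace
    isClosed_range_pi_structureMapCLM.isComplete

end ContDiffMapSupportedIn

/-! ### Compact sets of test functions. -/

namespace TestFunction

variable {E F : Type*} [NormedAddCommGroup E] [NormedSpace ℝ E]
  [NormedAddCommGroup F] [NormedSpace ℝ F] {Ω : Opens E}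

section BoundedJets

theorem isTopologicalAddGroup_boundedContinuousFunction (α G : Type*) [TopologicalSpace α]
    [SeminormedAddCommGroup G] : IsTopologicalAddGroup (α →ᵇ G) :=
  inferInstance

theorem locallyConvexSpace_boundedContinuousFunction (α G : Type*) [TopologicalSpace α]
    [SeminormedAddCommGroup G] [NormedSpace ℝ G] : LocallyConvexSpace ℝ (α →ᵇ G) :=
  inferInstance

instance isTopologicalAddGroup_boundedJets (i : ℕ) :
    IsTopologicalAddGroup (E →ᵇ (E [×i]→L[ℝ] F)) :=
  isTopologicalAddGroup_boundedContinuousFunction _ _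

instance locallyConvexSpace_boundedJets (i : ℕ) :
    LocallyConvexSpace ℝ (E →ᵇ (E [×i]→L[ℝ] F)) :=
  locallyConvexSpace_boundedContinuousFunction _ _

end BoundedJets

/-- A test function as an element of `𝓓_K`, where `K` is its topological support. -/
def toSupportedIn (f : 𝓓(Ω, F)) : 𝓓_{⟨tsupport f, f.hasCompactSupport⟩}(E, F) :=
  .of_support_subset f.contDiff subset_closure

/-- The `i`-th derivative as a continuous linear map from test functions to bounded functions. -/
def iteratedFDerivBCF (i : ℕ) : 𝓓(Ω, F) →L[ℝ] E →ᵇ (E [×i]→L[ℝ] F) :=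
  TestFunction.limitCLM (V := E →ᵇ (E [×i]→L[ℝ] F)) ℝ
    (fun f : 𝓓(Ω, F) => ContDiffMapSupportedIn.structureMapCLM ℝ ⊤ i f.toSupportedIn)
    (fun _ _ => ContDiffMapSupportedIn.structureMapCLM ℝ ⊤ i)
    (fun K hK f => by
      ext x : 1
      simp only [ContDiffMapSupportedIn.structureMapCLM_top_apply]
      rfl)

theorem iteratedFDerivBCF_ofSupportedIn (i : ℕ) {K : Compacts E} (hK : (K : Set E) ⊆ Ω)
    (f : 𝓓_{K}(E, F)) : iteratedFDerivBCF i (ofSupportedIn hK f) =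
      ContDiffMapSupportedIn.structureMapCLM ℝ ⊤ i f := by
  ext x : 1
  simp only [iteratedFDerivBCF, TestFunction.limitCLM_apply,
    ContDiffMapSupportedIn.structureMapCLM_top_apply]
  rfl

/-- The jet maps defining the topology of `𝓓_K` extend continuously to all of `𝓓(Ω)`, so the
inductive limit topology restricts to nothing coarser. -/
theorem isInducing_ofSupportedIn {K : Compacts E} (hK : (K : Set E) ⊆ Ω) :
    IsInducing (ofSupportedIn hK : 𝓓_{K}(E, F) → 𝓓(Ω, F)) := by
  refine ⟨le_antisymm (continuous_ofSupportedIn hK).le_induced ?_⟩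
  refine le_iInf fun i => ?_
  have h : (ContDiffMapSupportedIn.structureMapLM ℝ ⊤ i : 𝓓_{K}(E, F) → _) =
      iteratedFDerivBCF i ∘ (ofSupportedIn hK : 𝓓_{K}(E, F) → 𝓓(Ω, F)) :=
    funext fun f => (iteratedFDerivBCF_ofSupportedIn i hK f).symm
  rw [h, ← induced_compose]
  exact induced_mono (iteratedFDerivBCF i).continuous.le_induced

theorem isUniformInducing_ofSupportedIn {K : Compacts E} (hK : (K : Set E) ⊆ Ω) :
    IsUniformInducing (ofSupportedInCLM ℝ hK : 𝓓_{K}(E, F) → 𝓓(Ω, F)) :=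
  AddMonoidHom.isUniformInducing_of_isInducing
    (f := (ofSupportedInCLM ℝ hK : 𝓓_{K}(E, F) →L[ℝ] 𝓓(Ω, F))) (isInducing_ofSupportedIn hK)

theorem mem_range_ofSupportedIn {K : Compacts E} (hK : (K : Set E) ⊆ Ω) {f : 𝓓(Ω, F)} :
    f ∈ range (ofSupportedInCLM ℝ hK : 𝓓_{K}(E, F) →L[ℝ] 𝓓(Ω, F)) ↔ ∀ x ∉ K, f x = 0 := by
  refine ⟨?_, fun h => ⟨⟨f, f.contDiff, fun x hx => h x hx⟩, rfl⟩⟩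
  rintro ⟨g, rfl⟩ x hx
  exact g.zero_on_compl hx

theorem isComplete_range_ofSupportedIn [CompleteSpace F] {K : Compacts E}
    (hK : (K : Set E) ⊆ Ω) :
    IsComplete (range (ofSupportedInCLM ℝ hK : 𝓓_{K}(E, F) →L[ℝ] 𝓓(Ω, F))) :=
  (isUniformInducing_ofSupportedIn hK).isComplete_range

/-- A compact set of test functions is supported in a common compact set. -/
theorem exists_compacts_of_isCompact [FiniteDimensional ℝ E] {S : Set 𝓓(Ω, F)}
    (hS : IsCompact S) : ∃ K : Compacts E, (K : Set E) ⊆ Ω ∧ ∀ f ∈ S, ∀ x ∉ K, f x = 0 := by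
  have : ProperSpace E := FiniteDimensional.proper ℝ E
  have : LocallyCompactSpace Ω := Ω.isOpen.locallyCompactSpace
  let X : CompactExhaustion Ω := default
  let X' : ℕ → Compacts E := fun n => ⟨(↑) '' X n, (X.isCompact n).image continuous_subtype_val⟩
  have hX' : ∀ n, (X' n : Set E) ⊆ Ω := fun n => by
    rintro _ ⟨x, -, rfl⟩
    exact x.2
  have hex : ∀ K : Compacts E, (K : Set E) ⊆ Ω → ∃ N, (K : Set E) ⊆ X' N := by
    intro K hK
    have hc : IsCompact ((↑) ⁻¹' (K : Set E) : Set Ω) :=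
      (Topology.IsEmbedding.subtypeVal.isCompact_preimage_iff (by simpa using hK)).2 K.isCompact
    obtain ⟨N, hN⟩ := X.exists_superset_of_isCompact hc
    exact ⟨N, fun x hx => ⟨⟨x, hK hx⟩, hN hx, rfl⟩⟩
  by_contra! hcon
  choose f hfS x hx hfx using fun n => hcon (X' n) (hX' n)
  -- The weights give `w n • f n (x n)` norm `n`. Each compact `K ⊆ Ω` contains only finitely many
  -- `x n`, so `g ↦ (w n • g (x n))` is continuous into bounded sequences, yet it is unbounded on
  -- `S`.
  let w : ℕ → ℝ := fun n => n / ‖f n (x n)‖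
  have hfin : ∀ K : Compacts E, (K : Set E) ⊆ Ω → ∃ C, 0 ≤ C ∧ ∀ n, x n ∈ K → w n ≤ C := by
    intro K hK
    obtain ⟨N, hN⟩ := hex K hK
    refine ⟨∑ n ∈ Finset.range N, w n, Finset.sum_nonneg fun _ _ => by positivity,
      fun n hn => ?_⟩
    have hnN : n < N := by
      by_contra! h
      exact hx n ((Set.image_mono (X.subset h)) (hN hn))
    exact Finset.single_le_sum (f := w) (fun _ _ => by positivity) (Finset.mem_range.2 hnN)
  have hbd : ∀ K : Compacts E, (K : Set E) ⊆ Ω → ∃ C, 0 ≤ C ∧ ∀ (g : 𝓓_{K}(E, F)) (n : ℕ),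
      ‖w n • g (x n)‖ ≤ C * (({0} : Finset ℕ).sup fun i => N[ℝ]_{K, ⊤, i}) g := by
    intro K hK
    obtain ⟨C, hC, h⟩ := hfin K hK
    refine ⟨C, hC, fun g n => ?_⟩
    have hw : 0 ≤ w n := by positivity
    rw [Finset.sup_singleton, norm_smul, Real.norm_of_nonneg hw]
    by_cases hn : x n ∈ K
    · exact mul_le_mul (h n hn) (ContDiffMapSupportedIn.norm_apply_le_seminorm ℝ)
        (norm_nonneg _) hC
    · rw [g.zero_on_compl hn]
      simpa using mul_nonneg hC (apply_nonneg _ _)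
  let Φ : 𝓓(Ω, F) →L[ℝ] ℕ →ᵇ F := TestFunction.mkCLM ℝ
    (fun g => BoundedContinuousFunction.ofNormedAddCommGroupDiscrete (fun n => w n • g (x n))
      ((hbd _ g.tsupport_subset).choose * (({0} : Finset ℕ).sup fun i =>
        N[ℝ]_{(⟨tsupport g, g.hasCompactSupport⟩ : Compacts E), ⊤, i}) g.toSupportedIn)
      (fun n => (hbd ⟨tsupport g, g.hasCompactSupport⟩ g.tsupport_subset).choose_spec.2
        g.toSupportedIn n))
    (fun g h => by ext n; exact smul_add _ _ _)
    (fun c g => by ext n; exact smul_comm _ _ _)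
    (fun K hK => by
      obtain ⟨C, hC, h⟩ := hbd K hK
      exact (ContDiffMapSupportedIn.mkCLMtoNormedSpace ℝ
        (fun g : 𝓓_{K}(E, F) =>
          BoundedContinuousFunction.ofNormedAddCommGroupDiscrete (fun n => w n • g (x n)) _ (h g))
        (fun g h => by ext n; exact smul_add _ _ _)
        (fun c g => by ext n; exact smul_comm _ _ _)
        ⟨{0}, C, hC, fun g => BoundedContinuousFunction.norm_ofNormedAddCommGroup_le _
          (mul_nonneg hC (apply_nonneg _ _)) _⟩).continuous)
  obtain ⟨C, hC⟩ := (hS.image Φ.continuous).isBounded.exists_norm_le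
  obtain ⟨n, hn⟩ := exists_nat_gt C
  have h1 : ‖Φ (f n) n‖ ≤ C :=
    ((Φ (f n)).norm_coe_le_norm n).trans (hC _ (mem_image_of_mem _ (hfS n)))
  have h2 : Φ (f n) n = w n • f n (x n) := rfl
  have h3 : 0 < ‖f n (x n)‖ := norm_pos_iff.2 (hfx n)
  rw [h2, norm_smul, Real.norm_of_nonneg (by positivity), div_mul_cancel₀ _ h3.ne'] at h1
  exact absurd h1 (not_le.2 hn)

/-- The closed convex hull of a compact set of test functions is compact. -/
theorem isCompact_closure_convexHull [FiniteDimensional ℝ E] [CompleteSpace F] {S : Set 𝓓(Ω, F)}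
    (hS : IsCompact S) : IsCompact (closure (convexHull ℝ S)) := by
  obtain ⟨K, hK, hSK⟩ := exists_compacts_of_isCompact hS
  -- The hull stays in the copy of `𝓓_K`, whose completeness replaces that of `𝓓(Ω)`; total
  -- boundedness passes to convex hulls.
  have hr := isComplete_range_ofSupportedIn (F := F) hK
  have hsub : convexHull ℝ S ⊆ range (ofSupportedInCLM ℝ hK : 𝓓_{K}(E, F) →L[ℝ] 𝓓(Ω, F)) := by
    exact convexHull_min (fun f hf => (mem_range_ofSupportedIn hK).2 (hSK f hf))
      (LinearMap.range (ofSupportedInCLM ℝ hK : 𝓓_{K}(E, F) →L[ℝ] 𝓓(Ω, F)).toLinearMap).convex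
  refine isCompact_iff_totallyBounded_isComplete.2
    ⟨(totallyBounded_convexHull.2 hS.totallyBounded).closure,
      fun f hf hfs => ?_⟩
  obtain ⟨g, -, hg⟩ := hr f hf
    (hfs.trans (principal_mono.2 (closure_minimal hsub hr.isClosed)))
  have := hf.1
  exact ⟨g, isClosed_closure.mem_of_tendsto (f := id) hg (le_principal_iff.1 hfs), hg⟩

end TestFunction

/-! ### The dual of the space of distributions. -/

namespace Distribution

variable {E : Type*} [NormedAddCommGroup E] [NormedSpace ℝ E]
  {Ω : Opens E}

/-- A functional that is small on the distributions that are small on the compact convex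
symmetric set `C` agrees on finitely many distributions with the evaluation at a point of `C`. -/
theorem exists_mem_forall_mem_finset_eq {C : Set 𝓓(Ω, ℝ)} (hC : IsCompact C)
    (hconv : Convex ℝ C) (hneg : ∀ φ ∈ C, -φ ∈ C) (h0 : (0 : 𝓓(Ω, ℝ)) ∈ C)
    (ℓ : 𝓓'(Ω, ℝ) →ₗ[ℝ] ℝ) (hℓ : ∀ T : 𝓓'(Ω, ℝ), (∀ φ ∈ C, |T φ| < 1) → ℓ T ≤ 1)
    (s : Finset 𝓓'(Ω, ℝ)) : ∃ φ ∈ C, ∀ T ∈ s, T φ = ℓ T := by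
  let Φ : 𝓓(Ω, ℝ) →L[ℝ] (s → ℝ) := ContinuousLinearMap.pi fun T => (T.1 : 𝓓(Ω, ℝ) →L[ℝ] ℝ)
  classical
  by_cases hmem : (fun T : s => ℓ T) ∈ Φ '' C
  · obtain ⟨φ, hφ, h⟩ := hmem
    exact ⟨φ, hφ, fun T hT => congr_fun h ⟨T, hT⟩⟩
  -- A functional `a` separating `(ℓ T)` from `Φ '' C` in `ℝ^s` is evaluation of the distribution
  -- `T₀ = ∑ a_i T_i`. By symmetry of `C`, `u⁻¹ • T₀` is smaller than `1` in absolute value on `C`,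
  -- while `ℓ` exceeds `1` on it.
  obtain ⟨a, u, hau, hua⟩ := geometric_hahn_banach_closed_point
    (hconv.linear_image Φ.toLinearMap) (hC.image Φ.continuous).isClosed hmem
  have hu : 0 < u := by simpa using hau _ (mem_image_of_mem Φ h0)
  have ha : ∀ v : s → ℝ, a v = ∑ i, a (Pi.single i 1) * v i := by
    intro v
    conv_lhs => rw [pi_eq_sum_univ' v]
    rw [map_sum]
    refine Finset.sum_congr rfl fun i _ => ?_
    rw [map_smul, smul_eq_mul, mul_comm]
  let T₀ : 𝓓'(Ω, ℝ) := ∑ i : s, a (Pi.single i 1) • (i : 𝓓'(Ω, ℝ))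
  have hT₀ : ∀ φ, T₀ φ = a (Φ φ) := by
    intro φ
    rw [ha]
    simp only [T₀]
    rw [sum_apply]
    rfl
  have hℓT₀ : ℓ T₀ = a (fun T => ℓ T) := by
    rw [ha]
    simp [T₀]
  have hlt : ∀ φ ∈ C, |(u⁻¹ • T₀) φ| < 1 := by
    intro φ hφ
    have h1 := hau _ (mem_image_of_mem Φ hφ)
    have h2 := hau _ (mem_image_of_mem Φ (hneg φ hφ))
    have : (u⁻¹ • T₀) φ = u⁻¹ * a (Φ φ) := by rw [← hT₀]; rfl
    change a (Φ φ) < u at h1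
    change a (Φ (-φ)) < u at h2
    rw [map_neg, map_neg] at h2
    rw [this, abs_mul, abs_of_pos (inv_pos.2 hu), inv_mul_lt_one₀ hu, abs_lt]
    constructor <;> linarith
  have h3 := hℓ _ hlt
  rw [map_smul, smul_eq_mul, inv_mul_le_one₀ hu, hℓT₀] at h3
  exact absurd hua (not_lt.2 h3)

/-- The dual of the space of real distributions is the space of test functions. -/
theorem exists_testFunction_forall_eq [FiniteDimensional ℝ E] (ℓ : 𝓓'(Ω, ℝ) →L[ℝ] ℝ) :
    ∃ ψ : 𝓓(Ω, ℝ), ∀ T : 𝓓'(Ω, ℝ), ℓ T = T ψ := by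
  have hnhds : ∀ᶠ T in 𝓝 (0 : 𝓓'(Ω, ℝ)), ℓ T ≤ 1 := by
    have : Tendsto ℓ (𝓝 0) (𝓝 0) := by simpa using ℓ.continuous.tendsto 0
    exact this.eventually_le_const one_pos
  obtain ⟨⟨S, ε⟩, ⟨hS, hε⟩, hSε⟩ := ((CompactConvergenceCLM.hasBasis_nhds_zero_of_basis
    (E := 𝓓(Ω, ℝ)) (σ := RingHom.id ℝ) Metric.nhds_basis_ball).eventually_iff).1 hnhds
  simp only at hS hε
  -- Scaling by `ε⁻¹` turns the bound `ε` on `S` into `1`; the two signs and `0` supply the symmetry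
  -- needed for separation.
  let S' : Set 𝓓(Ω, ℝ) := insert 0 (((fun φ => ε⁻¹ • φ) '' S) ∪ ((fun φ => -(ε⁻¹ • φ)) '' S))
  have hS' : IsCompact S' :=
    ((hS.image (continuous_const_smul _)).union (hS.image (continuous_const_smul _).neg)).insert 0
  have hnegS' : ∀ φ ∈ S', -φ ∈ S' := by
    rintro φ (rfl | ⟨χ, hχ, rfl⟩ | ⟨χ, hχ, rfl⟩)
    · simp [S']
    · exact Or.inr (Or.inr ⟨χ, hχ, rfl⟩)
    · exact Or.inr (Or.inl ⟨χ, hχ, by simp⟩)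
  let C := closure (convexHull ℝ S')
  have hsub : S' ⊆ C := (subset_convexHull ℝ S').trans subset_closure
  have hneg : ∀ φ ∈ C, -φ ∈ C := by
    intro φ hφ
    have h1 : MapsTo (fun φ : 𝓓(Ω, ℝ) => -φ) (convexHull ℝ S') (convexHull ℝ S') := by
      have : -(convexHull ℝ S') = convexHull ℝ S' := by
        rw [← convexHull_neg]
        congr 1
        ext φ
        exact ⟨fun h => by simpa using hnegS' _ h, fun h => hnegS' _ h⟩
      intro φ hφ
      rw [← this]
      simpa using hφ
    exact h1.closure continuous_neg hφ
  have hℓ : ∀ T : 𝓓'(Ω, ℝ), (∀ φ ∈ C, |T φ| < 1) → (ℓ : 𝓓'(Ω, ℝ) →ₗ[ℝ] ℝ) T ≤ 1 := by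
    intro T hT
    refine hSε fun φ hφ => ?_
    have h := hT _ (hsub (Or.inr (Or.inl ⟨φ, hφ, rfl⟩)))
    simp only [map_smul, smul_eq_mul, abs_mul, abs_inv, abs_of_pos hε] at h
    rw [inv_mul_lt_one₀ hε] at h
    simpa using h
  have hC := TestFunction.isCompact_closure_convexHull hS'
  -- Each finite set of conditions `T φ = ℓ T` is solvable in `C`; compactness solves all of them at
  -- once.
  obtain ⟨ψ, -, hψ⟩ := hC.inter_iInter_nonempty
    (fun T : 𝓓'(Ω, ℝ) => {φ : 𝓓(Ω, ℝ) | T φ = ℓ T})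
    (fun T => isClosed_eq (ContinuousLinearMap.continuous T) continuous_const)
    (fun s => by
      obtain ⟨φ, hφ, h⟩ := exists_mem_forall_mem_finset_eq hC (convex_convexHull ℝ S').closure hneg
        (hsub (mem_insert _ _)) ℓ hℓ s
      exact ⟨φ, hφ, by simpa using h⟩)
  exact ⟨ψ, fun T => (mem_iInter.1 hψ T).symm⟩

variable {𝕜 : Type*} [RCLike 𝕜]

/-- A real distribution as an element of `𝓓'(Ω, 𝕜)`. -/
def ofRealCLM : 𝓓'(Ω, ℝ) →L[ℝ] 𝓓'(Ω, 𝕜) := mapCLM RCLike.ofRealCLM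

theorem ofRealCLM_apply (T : 𝓓'(Ω, ℝ)) (φ : 𝓓(Ω, ℝ)) :
    (ofRealCLM T : 𝓓'(Ω, 𝕜)) φ = (T φ : 𝕜) := rfl

theorem eq_ofRealCLM_re_add_I_smul (S : 𝓓'(Ω, 𝕜)) :
    S = ofRealCLM (mapCLM RCLike.reCLM S) +
      (RCLike.I : 𝕜) • (ofRealCLM (mapCLM RCLike.imCLM S) : 𝓓'(Ω, 𝕜)) := by
  ext φ
  change S φ = (RCLike.re (S φ) : 𝕜) + RCLike.I * (RCLike.im (S φ) : 𝕜)
  rw [mul_comm, RCLike.re_add_im]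

/-- The dual of the space of `𝕜`-valued distributions is the space of `𝕜`-valued test functions,
which are written here as pairs of real test functions. -/
theorem exists_testFunction_pair_forall_eq [FiniteDimensional ℝ E] (ℓ : 𝓓'(Ω, 𝕜) →L[𝕜] 𝕜) :
    ∃ ψ₁ ψ₂ : 𝓓(Ω, ℝ), ∀ S : 𝓓'(Ω, 𝕜), ℓ S = S ψ₁ + RCLike.I * S ψ₂ := by
  have hc : Continuous fun T : 𝓓'(Ω, ℝ) => ℓ (ofRealCLM T) := ℓ.continuous.comp ofRealCLM.continuous
  let ℓ₀ : 𝓓'(Ω, ℝ) →L[ℝ] 𝕜 :=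
    { toFun := fun T => ℓ (ofRealCLM T)
      map_add' := fun S T => by simp
      map_smul' := fun c T => by
        have : (ofRealCLM (c • T) : 𝓓'(Ω, 𝕜)) = (c : 𝕜) • ofRealCLM T := by
          ext φ
          simp [ofRealCLM_apply]
        rw [this, map_smul, RingHom.id_apply, RCLike.real_smul_eq_coe_mul, smul_eq_mul]
      cont := hc }
  obtain ⟨ψ₁, h₁⟩ := exists_testFunction_forall_eq (RCLike.reCLM ∘L ℓ₀)
  obtain ⟨ψ₂, h₂⟩ := exists_testFunction_forall_eq (RCLike.imCLM ∘L ℓ₀)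
  have h : ∀ T : 𝓓'(Ω, ℝ), ℓ (ofRealCLM T) = (T ψ₁ : 𝕜) + RCLike.I * (T ψ₂ : 𝕜) := by
    intro T
    rw [← h₁ T, ← h₂ T, mul_comm]
    exact (RCLike.re_add_im _).symm
  refine ⟨ψ₁, ψ₂, fun S => ?_⟩
  conv_lhs => rw [eq_ofRealCLM_re_add_I_smul S]
  conv_rhs => rw [eq_ofRealCLM_re_add_I_smul S]
  rw [map_add, map_smul, h, h]
  simp only [add_apply, smul_apply, smul_eq_mul, ofRealCLM_apply]
  ring

end Distribution

/-! ### Moments, dilations and the transpose. -/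

namespace Hadamard

variable {d : ℕ}

theorem integral_mul_eval_eq_zero {f : (Fin d → ℝ) → ℝ} (hf : Continuous f)
    (hfc : HasCompactSupport f) (h : ∀ α : Fin d →₀ ℕ, ∫ x, f x * ∏ j, x j ^ α j = 0)
    (p : MvPolynomial (Fin d) ℝ) : ∫ x, f x * p.eval x = 0 := by
  have hint : ∀ p : MvPolynomial (Fin d) ℝ, Integrable fun x => f x * p.eval x := fun p =>
    (hf.mul p.continuous_eval).integrable_of_hasCompactSupport hfc.mul_right
  induction p using MvPolynomial.induction_on' with
  | monomial α a =>
    have : ∀ x, f x * MvPolynomial.eval x (MvPolynomial.monomial α a) =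
        a * (f x * ∏ j, x j ^ α j) := by
      intro x
      rw [MvPolynomial.eval_monomial, Finsupp.prod_fintype _ _ (by simp)]
      ring
    simp_rw [this]
    rw [integral_const_mul, h, mul_zero]
  | add p q hp hq =>
    simp_rw [map_add, mul_add]
    rw [integral_add (hint p) (hint q), hp, hq, add_zero]

/-- Polynomials approximate continuous functions uniformly on compact sets of `ℝ^d`. -/
theorem exists_mvPolynomial_near {f : (Fin d → ℝ) → ℝ} (hf : Continuous f)
    {K : Set (Fin d → ℝ)} (hK : IsCompact K) {ε : ℝ} (hε : 0 < ε) :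
    ∃ p : MvPolynomial (Fin d) ℝ, ∀ x ∈ K, |p.eval x - f x| < ε := by
  let c : Fin d → C(Fin d → ℝ, ℝ) := fun j => ⟨fun x => x j, continuous_apply j⟩
  have hsep : (MvPolynomial.aeval c : MvPolynomial (Fin d) ℝ →ₐ[ℝ] _).range.SeparatesPoints := by
    intro x y hxy
    obtain ⟨j, hj⟩ := Function.ne_iff.1 hxy
    exact ⟨c j, ⟨c j, ⟨MvPolynomial.X j, by simp⟩, rfl⟩, hj⟩
  obtain ⟨_, ⟨p, rfl⟩, hp⟩ :=
    ContinuousMap.exists_mem_subalgebra_near_continuous_of_isCompact_of_separatesPoints hsep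
      ⟨f, hf⟩ hK hε
  refine ⟨p, fun x hx => ?_⟩
  have h1 : (MvPolynomial.aeval c p : C(Fin d → ℝ, ℝ)) x = p.eval x := by
    have : (ContinuousMap.evalAlgHom ℝ ℝ x).comp (MvPolynomial.aeval c) =
        (MvPolynomial.aeval x : MvPolynomial (Fin d) ℝ →ₐ[ℝ] ℝ) := by
      ext j
      simp [c]
    rw [← MvPolynomial.coe_aeval_eq_eval]
    exact congr($this p)
  have h2 := hp x hx
  rw [← h1]
  exact h2

/-- A compactly supported continuous real function all of whose moments vanish is zero. -/
theorem eq_zero_of_forall_integral_mul_prod_pow_eq_zero {f : (Fin d → ℝ) → ℝ} (hf : Continuous f)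
    (hfc : HasCompactSupport f) (h : ∀ α : Fin d →₀ ℕ, ∫ x, f x * ∏ j, x j ^ α j = 0) : f = 0 := by
  by_contra hne
  obtain ⟨x₀, hx₀⟩ := Function.ne_iff.1 hne
  have hpos : 0 < ∫ x, f x * f x :=
    (hf.mul hf).integral_pos_of_hasCompactSupport_nonneg_nonzero hfc.mul_right
      (fun x => mul_self_nonneg _) (mul_self_ne_zero.2 hx₀)
  have hfi : Integrable f := hf.integrable_of_hasCompactSupport hfc
  set B : ℝ := ∫ x, |f x| with hB
  have hB0 : 0 ≤ B := integral_nonneg fun x => abs_nonneg _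
  -- With a polynomial `p` this close to `f`, `∫ f² = ∫ f (f - p) ≤ B / (B + 1) * ∫ f² < ∫ f²`, a
  -- contradiction.
  have hε : 0 < (∫ x, f x * f x) / (B + 1) := div_pos hpos (by linarith)
  obtain ⟨p, hp⟩ := exists_mvPolynomial_near hf hfc hε
  have hpi : Integrable fun x => f x * p.eval x :=
    (hf.mul p.continuous_eval).integrable_of_hasCompactSupport hfc.mul_right
  have hle : ∫ x, f x * f x ≤ ∫ x, (∫ x, f x * f x) / (B + 1) * |f x| + f x * p.eval x := by
    refine integral_mono ((hf.mul hf).integrable_of_hasCompactSupport hfc.mul_right)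
      ((hfi.abs.const_mul _).add hpi) fun x => ?_
    by_cases hx : x ∈ tsupport f
    · have h1 := (hp x hx).le
      have h2 : f x * (f x - p.eval x) ≤ |f x| * |p.eval x - f x| := by
        rw [← abs_neg (p.eval x - f x), neg_sub, ← abs_mul]
        exact le_abs_self _
      have h3 := h2.trans (mul_le_mul_of_nonneg_left h1 (abs_nonneg _))
      simp only
      linarith
    · simp [image_eq_zero_of_notMem_tsupport hx]
  rw [integral_add (hfi.abs.const_mul _) hpi, integral_mul_eval_eq_zero hf hfc h, add_zero, integral_const_mul, ← hB,
      div_mul_eq_mul_div, le_div_iff₀ (by linarith)] at hle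
  linarith

variable {𝕜 : Type*} [RCLike 𝕜]

/-- A compactly supported continuous function all of whose moments vanish is zero. -/
theorem eq_zero_of_forall_moment_eq_zero {f : (Fin d → ℝ) → 𝕜} (hf : Continuous f)
    (hfc : HasCompactSupport f)
    (h : ∀ α : Fin d →₀ ℕ, ∫ x, f x * ∏ j, (x j : 𝕜) ^ α j = 0) : f = 0 := by
  have hint : ∀ α : Fin d →₀ ℕ, Integrable fun x => f x * ∏ j, (x j : 𝕜) ^ α j := fun α =>
    Continuous.integrable_of_hasCompactSupport (by fun_prop) hfc.mul_right
  have hprod : ∀ (α : Fin d →₀ ℕ) (x : Fin d → ℝ), ∏ j, (x j : 𝕜) ^ α j =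
      ((∏ j, x j ^ α j : ℝ) : 𝕜) :=
    fun α x => by push_cast; rfl
  have hre : (fun x => RCLike.re (f x)) = 0 := by
    refine eq_zero_of_forall_integral_mul_prod_pow_eq_zero (RCLike.continuous_re.comp hf)
      (hfc.comp_left (map_zero _)) fun α => ?_
    have := congrArg RCLike.re (h α)
    rw [← integral_re (hint α), map_zero] at this
    simpa only [hprod, mul_comm (f _), RCLike.re_ofReal_mul, mul_comm (RCLike.re _)] using this
  have him : (fun x => RCLike.im (f x)) = 0 := by
    refine eq_zero_of_forall_integral_mul_prod_pow_eq_zero (RCLike.continuous_im.comp hf)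
      (hfc.comp_left (map_zero _)) fun α => ?_
    have := congrArg RCLike.im (h α)
    rw [← integral_im (hint α), map_zero] at this
    simpa only [hprod, mul_comm (f _), RCLike.im_ofReal_mul, mul_comm (RCLike.im _)] using this
  funext x
  exact RCLike.ext (by simpa using congr_fun hre x) (by simpa using congr_fun him x)

/-- The dilation `x ↦ η x` of `ℝ^d`. -/
def dilation (η : Fin d → ℝˣ) : (Fin d → ℝ) ≃L[ℝ] (Fin d → ℝ) :=
  ContinuousLinearEquiv.piCongrRight fun j => ContinuousLinearEquiv.unitsEquivAut ℝ (η j)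

theorem dilation_apply (η : Fin d → ℝˣ) (x : Fin d → ℝ) (j : Fin d) :
    dilation η x j = x j * η j := rfl

theorem dilation_inv_dilation (η : Fin d → ℝˣ) (x : Fin d → ℝ) :
    dilation η⁻¹ (dilation η x) = x := by
  ext j
  simp [dilation_apply]

theorem dilation_dilation_inv (η : Fin d → ℝˣ) (x : Fin d → ℝ) :
    dilation η (dilation η⁻¹ x) = x := by
  ext j
  simp [dilation_apply]

/-- The value of the Jacobian factor is irrelevant; what matters is that one constant serves all
`f`, as it is applied to `φ` and to its transpose alike. -/
theorem exists_integral_comp_dilation (η : Fin d → ℝˣ) :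
    ∃ c : ℝ, ∀ f : (Fin d → ℝ) → 𝕜, ∫ x, f (dilation η x) = c • ∫ x, f x := by
  have hdet : LinearMap.det ((dilation η).toLinearEquiv : (Fin d → ℝ) →ₗ[ℝ] (Fin d → ℝ)) ≠ 0 :=
    (LinearEquiv.isUnit_det' _).ne_zero
  refine ⟨(ENNReal.ofReal |(LinearMap.det
    ((dilation η).toLinearEquiv : (Fin d → ℝ) →ₗ[ℝ] (Fin d → ℝ)))⁻¹|).toReal, fun f => ?_⟩
  have h1 := Measure.map_linearMap_addHaar_eq_smul_addHaar (volume : Measure (Fin d → ℝ)) hdet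
  have h2 : ∫ x, f (dilation η x) = ∫ x, f x ∂(Measure.map (dilation η) volume) :=
    ((dilation η).toHomeomorph.measurableEmbedding.integral_map f).symm
  rw [h2]
  change ∫ x, f x ∂(Measure.map
    ((dilation η).toLinearEquiv : (Fin d → ℝ) →ₗ[ℝ] (Fin d → ℝ)) volume) = _
  rw [h1, integral_smul_measure]

variable {Ω : Opens (Fin d → ℝ)}

/-- The transpose of an operator on distributions applied to a test function. -/
def transpose (L : 𝓓'(Ω, 𝕜) →L[𝕜] 𝓓'(Ω, 𝕜)) (φ : 𝓓(Ω, ℝ)) (x : Fin d → ℝ) : 𝕜 :=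
  L (Distribution.ofRealCLM (Distribution.delta x)) φ

/-- `S ↦ L S φ` is a continuous functional, hence given by a pair of test functions; testing it on
delta distributions identifies that pair with the pointwise defined `transpose`. -/
theorem exists_transpose_eq (L : 𝓓'(Ω, 𝕜) →L[𝕜] 𝓓'(Ω, 𝕜)) (φ : 𝓓(Ω, ℝ)) :
    ∃ ψ₁ ψ₂ : 𝓓(Ω, ℝ), (∀ S, L S φ = S ψ₁ + RCLike.I * S ψ₂) ∧
      ∀ x, transpose L φ x = ψ₁ x + RCLike.I * ψ₂ x := by
  let ev : 𝓓'(Ω, 𝕜) →L[𝕜] 𝕜 :=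
    { toFun := fun S => S φ
      map_add' := fun _ _ => rfl
      map_smul' := fun _ _ => rfl
      cont := continuous_eval_const φ }
  obtain ⟨ψ₁, ψ₂, h⟩ := Distribution.exists_testFunction_pair_forall_eq (ev ∘L L)
  exact ⟨ψ₁, ψ₂, h, fun x => h _⟩

theorem continuous_transpose (L : 𝓓'(Ω, 𝕜) →L[𝕜] 𝓓'(Ω, 𝕜)) (φ : 𝓓(Ω, ℝ)) :
    Continuous (transpose L φ) := by
  obtain ⟨ψ₁, ψ₂, -, h⟩ := exists_transpose_eq L φ
  rw [funext h]
  fun_prop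

theorem transpose_eq_zero_of_notMem (L : 𝓓'(Ω, 𝕜) →L[𝕜] 𝓓'(Ω, 𝕜)) (φ : 𝓓(Ω, ℝ))
    {x : Fin d → ℝ} (hx : x ∉ Ω) : transpose L φ x = 0 := by
  rw [transpose, Distribution.delta_eq_zero_of_notMem x hx, map_zero, map_zero]
  rfl

theorem hasCompactSupport_transpose (L : 𝓓'(Ω, 𝕜) →L[𝕜] 𝓓'(Ω, 𝕜)) (φ : 𝓓(Ω, ℝ)) :
    HasCompactSupport (transpose L φ) := by
  obtain ⟨ψ₁, ψ₂, -, h⟩ := exists_transpose_eq L φ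
  rw [funext h]
  exact (ψ₁.hasCompactSupport.comp_left (g := fun t : ℝ => (t : 𝕜)) (by simp)).add
    ((ψ₂.hasCompactSupport.comp_left (g := fun t : ℝ => (t : 𝕜)) (by simp)).mul_left)

theorem integral_transpose (L : 𝓓'(Ω, 𝕜) →L[𝕜] 𝓓'(Ω, 𝕜)) (φ : 𝓓(Ω, ℝ)) (α : Fin d →₀ ℕ) :
    ∫ x, transpose L φ x * ∏ j, (x j : 𝕜) ^ α j = L (monomialDist 𝕜 Ω α) φ := by
  obtain ⟨ψ₁, ψ₂, h, h'⟩ := exists_transpose_eq L φ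
  have hint : ∀ ψ : 𝓓(Ω, ℝ), Integrable fun x => ψ x • ∏ j, (x j : 𝕜) ^ α j := fun ψ =>
    Continuous.integrable_of_hasCompactSupport (by fun_prop) ψ.hasCompactSupport.smul_right
  rw [h, monomialDist_apply, monomialDist_apply, ← integral_const_mul, ← integral_add (hint _)
    ((hint _).const_mul _)]
  refine integral_congr_ae (Eventually.of_forall fun x => ?_)
  simp only
  rw [h', RCLike.real_smul_eq_coe_mul, RCLike.real_smul_eq_coe_mul]
  ring

theorem integral_comp_dilation_mul_prod_pow (η : Fin d → ℝˣ) (α : Fin d →₀ ℕ) :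
    ∃ c : 𝕜, ∀ f : (Fin d → ℝ) → 𝕜, ∫ x, f (dilation η x) * ∏ j, (x j : 𝕜) ^ α j =
      c * ∫ x, f x * ∏ j, (x j : 𝕜) ^ α j := by
  obtain ⟨c, hc⟩ := exists_integral_comp_dilation (𝕜 := 𝕜) η
  refine ⟨(∏ j, (((η⁻¹ : Fin d → ℝˣ) j : ℝ) : 𝕜) ^ α j) * (c : 𝕜), fun f => ?_⟩
  have h := hc fun x => f x * ∏ j, (dilation η⁻¹ x j : 𝕜) ^ α j
  simp only [dilation_inv_dilation] at h
  rw [h, RCLike.real_smul_eq_coe_mul, mul_comm _ (c : 𝕜), mul_assoc,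
    ← integral_const_mul (∏ j, (((η⁻¹ : Fin d → ℝˣ) j : ℝ) : 𝕜) ^ α j)]
  refine congrArg _ (integral_congr_ae (Eventually.of_forall fun x => ?_))
  simp only [dilation_apply, RCLike.ofReal_mul, mul_pow, Finset.prod_mul_distrib]
  ring

/-- The transpose of a Hadamard operator commutes with dilations. -/
theorem IsHadamardOperator.transpose_comp_dilation {L : 𝓓'(Ω, 𝕜) →L[𝕜] 𝓓'(Ω, 𝕜)}
    (hL : IsHadamardOperator L) {φ χ : 𝓓(Ω, ℝ)} {η : Fin d → ℝˣ}
    (h : ∀ x, χ x = φ (dilation η x)) (x : Fin d → ℝ) :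
    transpose L χ x = transpose L φ (dilation η x) := by
  have hd := (dilation η).toHomeomorph.isClosedEmbedding
  have key : (fun x => transpose L χ x - transpose L φ (dilation η x)) = 0 := by
    have hc1 := continuous_transpose L χ
    have hc2 := (continuous_transpose L φ).comp (dilation η).continuous
    have hs1 := hasCompactSupport_transpose L χ
    have hs2 := (hasCompactSupport_transpose L φ).comp_isClosedEmbedding hd
    -- Both `α`-th moments equal `c * m * ∫ φ x^α`: dilating contributes `c`, the eigenvalue
    -- contributes `m`, in either order.
    refine eq_zero_of_forall_moment_eq_zero (hc1.sub hc2) (hs1.sub hs2) fun α => ?_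
    have hi1 : Integrable fun x => transpose L χ x * ∏ j, (x j : 𝕜) ^ α j :=
      Continuous.integrable_of_hasCompactSupport (by fun_prop) hs1.mul_right
    have hi2 : Integrable fun x => transpose L φ (dilation η x) * ∏ j, (x j : 𝕜) ^ α j :=
      Continuous.integrable_of_hasCompactSupport (hc2.mul (by fun_prop)) hs2.mul_right
    obtain ⟨c, hc⟩ := integral_comp_dilation_mul_prod_pow (𝕜 := 𝕜) η α
    obtain ⟨m, hm⟩ := hL α
    have hm' : L (monomialDist 𝕜 Ω α) = m • monomialDist 𝕜 Ω α := hm.apply_eq_smul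
    have e1 : ∀ ψ : 𝓓(Ω, ℝ), L (monomialDist 𝕜 Ω α) ψ =
        m * ∫ x, (ψ x : 𝕜) * ∏ j, (x j : 𝕜) ^ α j := by
      intro ψ
      rw [hm', smul_apply, monomialDist_apply, smul_eq_mul]
      simp only [RCLike.real_smul_eq_coe_mul]
    simp only [sub_mul]
    rw [integral_sub hi1 hi2, hc, integral_transpose, integral_transpose, e1, e1]
    simp only [h]
    rw [hc fun x => (φ x : 𝕜)]
    ring
  exact sub_eq_zero.1 (congr_fun key x)

end Hadamard

/-! ### Locality of the transpose. -/

namespace Hadamard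

variable {d : ℕ} {Ω : Opens (Fin d → ℝ)}

/-- The product of a test function with a smooth function. -/
def mulTest {g : (Fin d → ℝ) → ℝ} (hg : ContDiff ℝ ∞ g) (φ : 𝓓(Ω, ℝ)) : 𝓓(Ω, ℝ) :=
  ⟨fun x => g x * φ x, hg.mul φ.contDiff, φ.hasCompactSupport.mul_left,
    (tsupport_mul_subset_right).trans φ.tsupport_subset⟩

theorem mulTest_apply {g : (Fin d → ℝ) → ℝ} (hg : ContDiff ℝ ∞ g) (φ : 𝓓(Ω, ℝ))
    (x : Fin d → ℝ) : mulTest hg φ x = g x * φ x := rfl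

theorem exists_testFunction_comp_dilation (η : Fin d → ℝˣ) (φ : 𝓓(Ω, ℝ))
    (h : ∀ x ∈ tsupport φ, dilation η⁻¹ x ∈ Ω) :
    ∃ χ : 𝓓(Ω, ℝ), ∀ x, χ x = φ (dilation η x) := by
  have hd := (dilation η).toHomeomorph
  have hsupp : tsupport (φ ∘ dilation η) = dilation η ⁻¹' tsupport φ :=
    tsupport_comp_eq_preimage φ (dilation η).toHomeomorph
  refine ⟨⟨φ ∘ dilation η, φ.contDiff.comp (dilation η).contDiff,
    φ.hasCompactSupport.comp_isClosedEmbedding (dilation η).toHomeomorph.isClosedEmbedding, ?_⟩,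
    fun x => rfl⟩
  rw [hsupp]
  intro x hx
  simpa [dilation_inv_dilation] using h _ hx

variable {𝕜 : Type*} [RCLike 𝕜]

/-- In logarithmic coordinates dilations are translations and `log Ω` is bounded. Translating `log
y` to a point of `log Ω` almost extremal in the direction `log x - log y` takes `log x` out of `log
Ω`, where the transpose vanishes. -/
theorem IsHadamardOperator.exists_nhds_transpose_eq_zero {L : 𝓓'(Ω, 𝕜) →L[𝕜] 𝓓'(Ω, 𝕜)}
    (hL : IsHadamardOperator L) (hΩ : RelativelyCompactIn (Ω : Set (Fin d → ℝ)) (posOrthant d))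
    {x y : Fin d → ℝ} (hx : x ∈ Ω) (hy : y ∈ Ω) (hxy : x ≠ y) :
    ∃ U : Set (Fin d → ℝ), IsOpen U ∧ y ∈ U ∧
      ∀ φ : 𝓓(Ω, ℝ), tsupport φ ⊆ U → transpose L φ x = 0 := by
  have hpos : ∀ z ∈ closure (Ω : Set (Fin d → ℝ)), ∀ j, 0 < z j := fun z hz => hΩ.2 hz
  have hpos' : ∀ z ∈ Ω, ∀ j, 0 < z j := fun z hz => hpos z (subset_closure hz)
  let s : Fin d → ℝ := fun j => Real.log (x j) - Real.log (y j)
  let F : (Fin d → ℝ) → ℝ := fun z => ∑ j, s j * Real.log (z j)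
  have hs : 0 < ∑ j, s j * s j := by
    obtain ⟨j, hj⟩ := Function.ne_iff.1 hxy
    refine Finset.sum_pos' (fun j _ => mul_self_nonneg _) ⟨j, Finset.mem_univ j, ?_⟩
    refine mul_self_pos.2 (sub_ne_zero.2 fun h => hj ?_)
    exact Real.log_injOn_pos (hpos' x hx j) (hpos' y hy j) h
  have hF : ContinuousOn F (closure (Ω : Set (Fin d → ℝ))) :=
    continuousOn_finsetSum _ fun j _ => continuousOn_const.mul
      ((continuous_apply j).continuousOn.log fun z hz => (hpos z hz j).ne')
  obtain ⟨w, hw, hmax⟩ := hΩ.1.exists_isMaxOn ⟨x, subset_closure hx⟩ hF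
  -- The maximum may sit on the boundary of `Ω`, hence an interior `z` losing less than `|s|²`,
  -- which is the gain of `F` in passing from the image `z` of `y` to the image of `x`.
  obtain ⟨z, hzw, hz⟩ : ∃ z, F w - ∑ j, s j * s j < F z ∧ z ∈ Ω := by
    have h1 : ∀ᶠ z in 𝓝[closure (Ω : Set (Fin d → ℝ))] w, F w - ∑ j, s j * s j < F z :=
      (hF w hw).eventually_const_lt (by linarith)
    have h2 : ∀ᶠ z in 𝓝[(Ω : Set (Fin d → ℝ))] w, F w - ∑ j, s j * s j < F z :=
      h1.filter_mono (nhdsWithin_mono _ subset_closure)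
    have : (𝓝[(Ω : Set (Fin d → ℝ))] w).NeBot := mem_closure_iff_nhdsWithin_neBot.1 hw
    exact (h2.and self_mem_nhdsWithin).exists
  let η : Fin d → ℝˣ := fun j =>
    Units.mk0 (y j / z j) (div_pos (hpos' y hy j) (hpos' z hz j)).ne'
  have hη : ∀ v j, dilation η⁻¹ v j = v j * (z j / y j) := fun v j => by
    simp [dilation_apply, η]
  refine ⟨dilation η⁻¹ ⁻¹' Ω, Ω.isOpen.preimage (dilation η⁻¹).continuous, ?_, fun φ hφ => ?_⟩
  · have : dilation η⁻¹ y = z := by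
      ext j
      rw [hη, mul_div_cancel₀ _ (hpos' y hy j).ne']
    rw [mem_preimage, this]
    exact hz
  · obtain ⟨χ, hχ⟩ := exists_testFunction_comp_dilation η φ hφ
    have h := hL.transpose_comp_dilation hχ (dilation η⁻¹ x)
    rw [dilation_dilation_inv] at h
    rw [← h]
    refine transpose_eq_zero_of_notMem L χ fun hmem => ?_
    have h1 : F (dilation η⁻¹ x) ≤ F w := hmax (subset_closure hmem)
    have h2 : F (dilation η⁻¹ x) = F z + ∑ j, s j * s j := by
      simp only [F]
      rw [← Finset.sum_add_distrib]
      refine Finset.sum_congr rfl fun j _ => ?_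
      rw [hη, Real.log_mul (hpos' x hx j).ne'
        (div_pos (hpos' z hz j) (hpos' y hy j)).ne',
        Real.log_div (hpos' z hz j).ne' (hpos' y hy j).ne']
      simp only [s]
      ring
    linarith

/-- The transpose of a Hadamard operator does not increase supports. -/
theorem IsHadamardOperator.transpose_eq_zero_of_notMem_tsupport {L : 𝓓'(Ω, 𝕜) →L[𝕜] 𝓓'(Ω, 𝕜)}
    (hL : IsHadamardOperator L) (hΩ : RelativelyCompactIn (Ω : Set (Fin d → ℝ)) (posOrthant d))
    {x : Fin d → ℝ} (φ : 𝓓(Ω, ℝ)) (hx : x ∉ tsupport φ) : transpose L φ x = 0 := by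
  by_cases hxΩ : x ∈ Ω
  swap
  · exact transpose_eq_zero_of_notMem L φ hxΩ
  have hex : ∀ y : tsupport φ, ∃ U : Set (Fin d → ℝ), IsOpen U ∧ (y : Fin d → ℝ) ∈ U ∧
      ∀ φ : 𝓓(Ω, ℝ), tsupport φ ⊆ U → transpose L φ x = 0 := fun y =>
    hL.exists_nhds_transpose_eq_zero hΩ hxΩ (φ.tsupport_subset y.2) fun h => hx (h ▸ y.2)
  choose U hUo hyU hU using hex
  obtain ⟨t, ht⟩ := φ.hasCompactSupport.isCompact.elim_finite_subcover U hUo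
    fun y hy => mem_iUnion.2 ⟨⟨y, hy⟩, hyU _⟩
  -- A partition of unity cuts `φ` into finitely many pieces, each supported in a set `U i` on which
  -- the local statement applies.
  obtain ⟨f, hf⟩ := SmoothPartitionOfUnity.exists_isSubordinate
    (modelWithCornersSelf ℝ (Fin d → ℝ)) (isClosed_tsupport φ) (fun i : t => U i)
    (fun i => hUo i) (fun y hy => by simpa using ht hy)
  have hfs : ∀ i, ContDiff ℝ ∞ (f i) := fun i => (f i).contMDiff.contDiff
  have hsum : φ = ∑ i : t, mulTest (hfs i) φ := by
    ext y
    have e : (∑ i : t, mulTest (hfs i) φ) y = ∑ i : t, f i y * φ y := by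
      rw [sum_apply]
      rfl
    rw [e, ← Finset.sum_mul]
    by_cases hy : y ∈ tsupport φ
    · have := f.sum_eq_one hy
      rw [finsum_eq_sum_of_fintype] at this
      rw [this, one_mul]
    · rw [image_eq_zero_of_notMem_tsupport hy, mul_zero]
  have hz : ∀ i : t, transpose L (mulTest (hfs i) φ) x = 0 := fun i =>
    hU _ _ ((tsupport_mul_subset_left).trans (hf i))
  rw [hsum, transpose, map_sum]
  exact Finset.sum_eq_zero fun i _ => hz i

end Hadamard

/-! ### Distributions supported at a point. -/

namespace Hadamard

/-- The derivatives of a function with vanishing `k`-jet at `a` are small near `a`. -/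
theorem norm_iteratedFDeriv_le_of_jet_eq_zero {E F : Type*} [NormedAddCommGroup E]
    [NormedSpace ℝ E] [NormedAddCommGroup F] [NormedSpace ℝ F] {f : E → F}
    (hf : ContDiff ℝ ∞ f) {a : E} {k : ℕ} {M : ℝ}
    (hM : ∀ x, ‖iteratedFDeriv ℝ (k + 1) f x‖ ≤ M)
    (hjet : ∀ i ≤ k, iteratedFDeriv ℝ i f a = 0) (n : ℕ) :
    ∀ i, i + n = k + 1 → ∀ x, ‖iteratedFDeriv ℝ i f x‖ ≤ M * ‖x - a‖ ^ n := by
  -- Downward induction on the order of differentiation: each step down integrates once from `a` by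
  -- the mean value inequality and gains a factor `‖x - a‖`.
  have hM0 : 0 ≤ M := (norm_nonneg _).trans (hM a)
  induction n with
  | zero =>
    rintro i hi x
    obtain rfl : i = k + 1 := by omega
    simpa using hM x
  | succ n ih =>
    intro i hi x
    have hd : Differentiable ℝ (iteratedFDeriv ℝ i f) :=
      hf.differentiable_iteratedFDeriv (by exact_mod_cast WithTop.coe_lt_top _)
    have h := (convex_closedBall a ‖x - a‖).norm_image_sub_le_of_norm_fderiv_le
      (f := iteratedFDeriv ℝ i f) (𝕜 := ℝ) (C := M * ‖x - a‖ ^ n) (x := a) (y := x)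
      (fun y _ => hd y) (fun y hy => ?_) (by simp) (by simp [dist_eq_norm])
    · rw [hjet i (by omega), sub_zero] at h
      rw [pow_succ, ← mul_assoc]
      exact h
    · rw [norm_fderiv_iteratedFDeriv]
      refine (ih (i + 1) (by omega) y).trans ?_
      have : ‖y - a‖ ≤ ‖x - a‖ := by simpa [dist_eq_norm] using hy
      gcongr

variable {E : Type*} [NormedAddCommGroup E] [NormedSpace ℝ E]

theorem norm_iteratedFDeriv_rescale_le {b : E → ℝ} (hb : ContDiff ℝ ∞ b) {ε : ℝ} (hε : 0 < ε)
    (a x : E) (j : ℕ) : ‖iteratedFDeriv ℝ j (fun y => b (ε⁻¹ • (y - a))) x‖ ≤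
      ‖iteratedFDeriv ℝ j b (ε⁻¹ • (x - a))‖ * ε⁻¹ ^ j := by
  let g : E →L[ℝ] E := ε⁻¹ • ContinuousLinearMap.id ℝ E
  have h1 : (fun y => b (ε⁻¹ • (y - a))) = fun y => (b ∘ g) (y - a) := rfl
  have hg : ‖g‖ ≤ ε⁻¹ := by
    refine ContinuousLinearMap.opNorm_le_bound _ (by positivity) fun v => ?_
    simp [g, norm_smul, abs_of_pos hε]
  rw [h1, iteratedFDeriv_comp_sub, g.iteratedFDeriv_comp_right hb _ (by exact_mod_cast le_top)]
  refine (ContinuousMultilinearMap.norm_compContinuousLinearMap_le _ _).trans ?_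
  rw [Finset.prod_const, Finset.card_univ, Fintype.card_fin]
  change ‖iteratedFDeriv ℝ j b (ε⁻¹ • (x - a))‖ * ‖g‖ ^ j ≤ _
  gcongr

/-- In the Leibniz formula `j` derivatives on the cutoff cost `ε⁻¹ ^ j`, but the remaining `i - j`
on `f` leave `ε ^ (k + 1 - i + j)`. The net power `k + 1 - i` is at least `1`. -/
theorem norm_iteratedFDeriv_cutoff_mul_le {b : E → ℝ} (hb : ContDiff ℝ ∞ b) {f : E → ℝ}
    (hf : ContDiff ℝ ∞ f) {a : E} {k : ℕ} {M B : ℝ}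
    (hM : ∀ x, ‖iteratedFDeriv ℝ (k + 1) f x‖ ≤ M)
    (hB : ∀ j ≤ k, ∀ x, ‖iteratedFDeriv ℝ j b x‖ ≤ B)
    (hjet : ∀ i ≤ k, iteratedFDeriv ℝ i f a = 0) {ε : ℝ} (hε : 0 < ε) (hε1 : ε ≤ 1) {i : ℕ}
    (hi : i ≤ k) {x : E} (hx : ‖x - a‖ ≤ ε) :
    ‖iteratedFDeriv ℝ i (fun y => b (ε⁻¹ • (y - a)) * f y) x‖ ≤ 2 ^ k * (B * M) * ε := by
  have hM0 : 0 ≤ M := (norm_nonneg _).trans (hM a)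
  have hB0 : 0 ≤ B := (norm_nonneg _).trans (hB 0 (Nat.zero_le _) a)
  have hc : ContDiff ℝ ∞ fun y => b (ε⁻¹ • (y - a)) := hb.comp (by fun_prop)
  refine (norm_iteratedFDeriv_mul_le hc hf x (n := i) (by exact_mod_cast le_top)).trans ?_
  have hterm : ∀ j ∈ Finset.range (i + 1), (i.choose j : ℝ) *
      ‖iteratedFDeriv ℝ j (fun y => b (ε⁻¹ • (y - a))) x‖ * ‖iteratedFDeriv ℝ (i - j) f x‖ ≤
      i.choose j * (B * M * ε) := by
    intro j hj
    have hji : j ≤ i := Finset.mem_range_succ_iff.1 hj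
    have h1 := (norm_iteratedFDeriv_rescale_le hb hε a x j).trans
      (mul_le_mul_of_nonneg_right (hB j (hji.trans hi) _) (by positivity))
    have h2 := norm_iteratedFDeriv_le_of_jet_eq_zero hf hM hjet (k + 1 - i + j) (i - j)
      (by omega) x
    have h3 : ‖iteratedFDeriv ℝ (i - j) f x‖ ≤ M * ε ^ (k + 1 - i + j) := h2.trans (by gcongr)
    have h4 : ε⁻¹ ^ j * ε ^ (k + 1 - i + j) ≤ ε := by
      rw [pow_add, inv_pow, mul_comm, mul_assoc, mul_inv_cancel₀ (by positivity), mul_one]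
      exact pow_le_of_le_one hε.le hε1 (by omega)
    rw [mul_assoc]
    refine mul_le_mul_of_nonneg_left ?_ (by positivity)
    calc _ ≤ (B * ε⁻¹ ^ j) * (M * ε ^ (k + 1 - i + j)) :=
          mul_le_mul h1 h3 (norm_nonneg _) (by positivity)
      _ = B * M * (ε⁻¹ ^ j * ε ^ (k + 1 - i + j)) := by ring
      _ ≤ B * M * ε := by gcongr
  refine (Finset.sum_le_sum hterm).trans ?_
  rw [← Finset.sum_mul, ← Nat.cast_sum, Nat.sum_range_choose, mul_assoc (2 ^ k)]
  push_cast
  exact mul_le_mul_of_nonneg_right (pow_le_pow_right₀ one_le_two hi) (by positivity)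

theorem exists_forall_norm_iteratedFDeriv_le {f : E → ℝ} (hf : ContDiff ℝ ∞ f)
    (hfc : HasCompactSupport f) (k : ℕ) :
    ∃ C, ∀ j ≤ k, ∀ x, ‖iteratedFDeriv ℝ j f x‖ ≤ C := by
  have h : ∀ j : ℕ, ∃ C, ∀ x, ‖iteratedFDeriv ℝ j f x‖ ≤ C := fun j =>
    (hf.continuous_iteratedFDeriv (by exact_mod_cast le_top)).bounded_above_of_compact_support
      (hfc.iteratedFDeriv j)
  choose C hC using h
  refine ⟨∑ j ∈ Finset.range (k + 1), C j, fun j hj x => (hC j x).trans ?_⟩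
  exact Finset.single_le_sum (f := C) (fun i _ => (norm_nonneg _).trans (hC i 0))
    (Finset.mem_range_succ_iff.2 hj)

variable {d : ℕ} {Ω : Opens (Fin d → ℝ)} {𝕜 : Type*} [RCLike 𝕜]

/-- A distribution on `Ω`, seen on a compact set, has finite order. -/
theorem exists_norm_le_of_forall_norm_iteratedFDeriv_le (T : 𝓓'(Ω, 𝕜))
    {K : Compacts (Fin d → ℝ)} (hK : (K : Set (Fin d → ℝ)) ⊆ Ω) :
    ∃ (k : ℕ) (C : ℝ), ∀ (φ : 𝓓(Ω, ℝ)) (A : ℝ), tsupport φ ⊆ K → 0 ≤ A →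
      (∀ i ≤ k, ∀ x ∈ K, ‖iteratedFDeriv ℝ i φ x‖ ≤ A) → ‖T φ‖ ≤ C * A := by
  let T' : 𝓓_{K}(Fin d → ℝ, ℝ) →L[ℝ] 𝕜 :=
    ContinuousLinearMap.comp (T : 𝓓(Ω, ℝ) →L[ℝ] 𝕜) (TestFunction.ofSupportedInCLM ℝ hK)
  obtain ⟨s, C, -, hC⟩ := Seminorm.bound_of_continuous
    (ContDiffMapSupportedIn.withSeminorms ℝ (Fin d → ℝ) ℝ ⊤ K)
    ((normSeminorm ℝ 𝕜).comp T'.toLinearMap) (continuous_norm.comp T'.continuous)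
  refine ⟨s.sup id, C, fun φ A hφ hA h => ?_⟩
  let f : 𝓓_{K}(Fin d → ℝ, ℝ) := .of_support_subset φ.contDiff ((subset_tsupport _).trans hφ)
  have h1 : ‖T φ‖ ≤ C * (s.sup (ContDiffMapSupportedIn.seminorm ℝ (Fin d → ℝ) ℝ ⊤ K)) f := hC f
  refine h1.trans (mul_le_mul_of_nonneg_left ?_ C.2)
  refine Seminorm.finset_sup_apply_le hA fun i hi => ?_
  rw [ContDiffMapSupportedIn.seminorm_top_le_iff ℝ hA]
  exact fun x hx => h i (Finset.le_sup (f := id) hi) x hx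

/-- A distribution supported at the point `a` depends only on a finite jet at `a`. -/
theorem exists_forall_jet_eq_zero_imp_eq_zero (T : 𝓓'(Ω, 𝕜)) {a : Fin d → ℝ} (ha : a ∈ Ω)
    (hT : ∀ φ : 𝓓(Ω, ℝ), a ∉ tsupport φ → T φ = 0) :
    ∃ k : ℕ, ∀ φ : 𝓓(Ω, ℝ), (∀ i ≤ k, iteratedFDeriv ℝ i φ a = 0) → T φ = 0 := by
  obtain ⟨r, hr, hrΩ⟩ := Metric.nhds_basis_closedBall.mem_iff.1 (Ω.isOpen.mem_nhds ha)
  let K : Compacts (Fin d → ℝ) := ⟨Metric.closedBall a r, isCompact_closedBall a r⟩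
  obtain ⟨k, C, hC⟩ := exists_norm_le_of_forall_norm_iteratedFDeriv_le T (K := K) hrΩ
  refine ⟨k, fun φ hjet => ?_⟩
  let b : ContDiffBump (0 : Fin d → ℝ) := ⟨1 / 2, 1, by norm_num, by norm_num⟩
  have hb : ContDiff ℝ ∞ b := b.contDiff
  obtain ⟨B, hB⟩ := exists_forall_norm_iteratedFDeriv_le hb b.hasCompactSupport k
  obtain ⟨M, hM⟩ := exists_forall_norm_iteratedFDeriv_le φ.contDiff φ.hasCompactSupport (k + 1)
  have hM0 : 0 ≤ M := (norm_nonneg _).trans (hM 0 (Nat.zero_le _) a)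
  have hB0 : 0 ≤ B := (norm_nonneg _).trans (hB 0 (Nat.zero_le _) a)
  -- `T` sees only the germ at `a`, so `φ` may be cut off at scale `ε`; the finite order estimate
  -- then tends to `0` with `ε`.
  have hmain : ∀ ε : ℝ, 0 < ε → ε ≤ 1 → ε ≤ r → ‖T φ‖ ≤ C * (2 ^ k * (B * M) * ε) := by
    intro ε hε hε1 hεr
    have hc : ContDiff ℝ ∞ fun y => b (ε⁻¹ • (y - a)) := hb.comp (by fun_prop)
    have hsupp : tsupport (fun y => b (ε⁻¹ • (y - a))) ⊆ Metric.closedBall a ε := by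
      refine closure_minimal (fun y hy => ?_) Metric.isClosed_closedBall
      have h1 : ε⁻¹ • (y - a) ∈ Function.support b := hy
      rw [b.support_eq, mem_ball_zero_iff, norm_smul, norm_inv, Real.norm_of_nonneg hε.le,
        inv_mul_lt_iff₀ hε] at h1
      rw [mem_closedBall_iff_norm]
      exact (by simpa [b] using h1 : ‖y - a‖ < ε).le
    have hsub : T φ = T (mulTest hc φ) := by
      rw [← sub_eq_zero, ← map_sub]
      refine hT _ ?_
      rw [notMem_tsupport_iff_eventuallyEq]
      have hev : ∀ᶠ y in 𝓝 a, ε⁻¹ • (y - a) ∈ Metric.ball (0 : Fin d → ℝ) (1 / 2) := by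
        have : ContinuousAt (fun y => ε⁻¹ • (y - a)) a := by fun_prop
        exact this.eventually_mem (by simpa using Metric.ball_mem_nhds _ (by norm_num))
      filter_upwards [hev] with y hy
      have : b (ε⁻¹ • (y - a)) = 1 := b.one_of_mem_closedBall (Metric.ball_subset_closedBall hy)
      rw [sub_apply, mulTest_apply, this, one_mul, sub_self, Pi.zero_apply]
    rw [hsub]
    refine hC _ _ ((tsupport_mul_subset_left).trans (hsupp.trans
      (Metric.closedBall_subset_closedBall hεr))) (by positivity) fun i hi x _ => ?_
    by_cases hx : ‖x - a‖ ≤ ε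
    · exact norm_iteratedFDeriv_cutoff_mul_le hb φ.contDiff (fun x => hM (k + 1) le_rfl x) hB hjet
        hε hε1 hi hx
    · have hx' : x ∉ tsupport (mulTest hc φ) := fun h =>
        hx (mem_closedBall_iff_norm.1 (hsupp (tsupport_mul_subset_left h)))
      have : iteratedFDeriv ℝ i (mulTest hc φ) x = 0 := by
        by_contra h
        exact hx' (support_iteratedFDeriv_subset i h)
      rw [this, norm_zero]
      positivity
  rw [← norm_le_zero_iff]
  have hlim : Tendsto (fun ε : ℝ => C * (2 ^ k * (B * M) * ε)) (𝓝[>] 0) (𝓝 0) := by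
    have : Continuous fun ε : ℝ => C * (2 ^ k * (B * M) * ε) := by fun_prop
    simpa using (this.tendsto 0).mono_left nhdsWithin_le_nhds
  refine ge_of_tendsto hlim ?_
  filter_upwards [self_mem_nhdsWithin, nhdsWithin_le_nhds (Iic_mem_nhds one_pos),
    nhdsWithin_le_nhds (Iic_mem_nhds hr)] with ε h0 h1 h2 using hmain ε h0 h1 h2

end Hadamard

/-! ### The transposes of the `θ_j`, and jets at points with nonzero coordinates. -/

namespace Hadamard

variable {d : ℕ} {Ω : Opens (Fin d → ℝ)}

/-- The partial derivative `φ ↦ ∂φ/∂x_j` of test functions. -/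
def partialTest (Ω : Opens (Fin d → ℝ)) (j : Fin d) : 𝓓(Ω, ℝ) →L[ℝ] 𝓓(Ω, ℝ) :=
  TestFunction.lineDerivCLM ℝ (Pi.single j 1 : Fin d → ℝ)

/-- The transpose `φ ↦ -∂(x_j φ)/∂x_j` of the operator `θ_j`. -/
def thetaTest (Ω : Opens (Fin d → ℝ)) (j : Fin d) : 𝓓(Ω, ℝ) →L[ℝ] 𝓓(Ω, ℝ) :=
  -(partialTest Ω j * coordMulTest Ω j)

theorem partialTest_apply (j : Fin d) (φ : 𝓓(Ω, ℝ)) (x : Fin d → ℝ) :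
    partialTest Ω j φ x = fderiv ℝ φ x (Pi.single j 1) := by
  rw [partialTest, TestFunction.lineDerivCLM_eq_fderivCLM,
    TestFunction.fderivCLM_apply_of_le φ (by simp)]

theorem partialTest_coordMulTest (i j : Fin d) (φ : 𝓓(Ω, ℝ)) :
    partialTest Ω i (coordMulTest Ω j φ) =
      coordMulTest Ω j (partialTest Ω i φ) + (Pi.single i (1 : ℝ) : Fin d → ℝ) j • φ := by
  ext x
  have h1 : HasFDerivAt φ (fderiv ℝ φ x) x :=
    (φ.contDiff.differentiable (by simp) x).hasFDerivAt
  have h2 : HasFDerivAt (fun y : Fin d → ℝ => y j) (ContinuousLinearMap.proj j) x :=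
    (ContinuousLinearMap.proj (R := ℝ) (φ := fun _ : Fin d => ℝ) j).hasFDerivAt
  have h3 : HasFDerivAt (coordMulTest Ω j φ) _ x := h1.mul h2
  rw [partialTest_apply, h3.fderiv]
  simp [coordMulTest_apply, partialTest_apply, mul_comm]
  ring

theorem partialTest_comm (i j : Fin d) (φ : 𝓓(Ω, ℝ)) :
    partialTest Ω i (partialTest Ω j φ) = partialTest Ω j (partialTest Ω i φ) := by
  ext x
  have hd : DifferentiableAt ℝ (fderiv ℝ φ) x :=
    (φ.contDiff.fderiv_right (m := ∞) (by simp)).differentiable (by simp) x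
  have h : ∀ u v : Fin d, partialTest Ω u (partialTest Ω v φ) x =
      fderiv ℝ (fderiv ℝ φ) x (Pi.single u 1) (Pi.single v 1) := by
    intro u v
    have : (partialTest Ω v φ : (Fin d → ℝ) → ℝ) = fun y => fderiv ℝ φ y (Pi.single v 1) :=
      funext fun y => partialTest_apply v φ y
    rw [partialTest_apply, this, fderiv_clm_apply hd (by fun_prop)]
    simp
  rw [h, h]
  exact (φ.contDiff.contDiffAt.isSymmSndFDerivAt
    (by rw [minSmoothness_of_isRCLikeNormedField]; exact WithTop.coe_le_coe.2 (le_top (a := (2 : ℕ∞))))) _ _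

theorem coordMulTest_comm (i j : Fin d) (φ : 𝓓(Ω, ℝ)) :
    coordMulTest Ω i (coordMulTest Ω j φ) = coordMulTest Ω j (coordMulTest Ω i φ) := by
  ext x
  simp only [coordMulTest_apply]
  ring

theorem commute_thetaTest (i j : Fin d) : Commute (thetaTest Ω i) (thetaTest Ω j) := by
  rcases eq_or_ne i j with rfl | hij
  · exact Commute.refl _
  have h1 : Commute (partialTest Ω i) (partialTest Ω j) :=
    ContinuousLinearMap.ext fun φ => partialTest_comm i j φ
  have h2 : Commute (coordMulTest Ω i) (coordMulTest Ω j) :=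
    ContinuousLinearMap.ext fun φ => coordMulTest_comm i j φ
  have h3 : ∀ u v : Fin d, u ≠ v → Commute (partialTest Ω u) (coordMulTest Ω v) :=
    fun u v huv => ContinuousLinearMap.ext fun φ => by
      have := partialTest_coordMulTest u v φ
      rwa [Pi.single_eq_of_ne huv.symm, zero_smul, add_zero] at this
  exact (Commute.mul_left (h1.mul_right (h3 i j hij))
    ((h3 j i hij.symm).symm.mul_right h2)).neg_left.neg_right

theorem thetaTest_apply_eq (j : Fin d) (φ : 𝓓(Ω, ℝ)) :
    thetaTest Ω j φ = -(coordMulTest Ω j (partialTest Ω j φ) + φ) := by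
  have := partialTest_coordMulTest j j φ
  rw [Pi.single_eq_same, one_smul] at this
  rw [← this]
  rfl

/-- The test functions all of whose images under products of at most `k` of the operators `B j`
vanish at `a`. -/
def wordKer (B : Fin d → 𝓓(Ω, ℝ) →L[ℝ] 𝓓(Ω, ℝ)) (a : Fin d → ℝ) : ℕ → Set 𝓓(Ω, ℝ)
  | 0 => {φ | φ a = 0}
  | k + 1 => {φ | φ a = 0 ∧ ∀ j, B j φ ∈ wordKer B a k}

section wordKer

variable {B : Fin d → 𝓓(Ω, ℝ) →L[ℝ] 𝓓(Ω, ℝ)} {a : Fin d → ℝ}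

theorem apply_eq_zero_of_mem_wordKer {k : ℕ} {φ : 𝓓(Ω, ℝ)} (h : φ ∈ wordKer B a k) : φ a = 0 := by
  cases k with
  | zero => exact h
  | succ k => exact h.1

theorem mem_wordKer_of_mem_succ {k : ℕ} {φ : 𝓓(Ω, ℝ)} (h : φ ∈ wordKer B a (k + 1)) :
    φ ∈ wordKer B a k := by
  induction k generalizing φ with
  | zero => exact h.1
  | succ k ih => exact ⟨h.1, fun j => ih (h.2 j)⟩

theorem add_mem_wordKer {k : ℕ} {φ χ : 𝓓(Ω, ℝ)} (hφ : φ ∈ wordKer B a k)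
    (hχ : χ ∈ wordKer B a k) : φ + χ ∈ wordKer B a k := by
  induction k generalizing φ χ with
  | zero =>
    change φ a + χ a = 0
    rw [apply_eq_zero_of_mem_wordKer hφ, apply_eq_zero_of_mem_wordKer hχ, add_zero]
  | succ k ih =>
    refine ⟨?_, fun j => ?_⟩
    · change φ a + χ a = 0
      rw [hφ.1, hχ.1, add_zero]
    · rw [map_add]
      exact ih (hφ.2 j) (hχ.2 j)

theorem smul_mem_wordKer {k : ℕ} {φ : 𝓓(Ω, ℝ)} (c : ℝ) (hφ : φ ∈ wordKer B a k) :
    c • φ ∈ wordKer B a k := by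
  induction k generalizing φ with
  | zero =>
    change c * φ a = 0
    rw [apply_eq_zero_of_mem_wordKer hφ, mul_zero]
  | succ k ih =>
    refine ⟨?_, fun j => ?_⟩
    · change c * φ a = 0
      rw [hφ.1, mul_zero]
    · rw [map_smul]
      exact ih (hφ.2 j)

end wordKer

/-- In `∂_i (x_j φ) = x_j ∂_i φ + δ_ij φ` the last term is already controlled one order lower, so
the factor `x_j`, nonzero at `a`, can be divided out inductively. -/
theorem mem_wordKer_of_coordMulTest_mem {a : Fin d → ℝ} {j : Fin d} (ha : a j ≠ 0) {k : ℕ}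
    {φ : 𝓓(Ω, ℝ)} (h : coordMulTest Ω j φ ∈ wordKer (partialTest Ω) a k) :
    φ ∈ wordKer (partialTest Ω) a k := by
  have h0 : φ a = 0 := by
    have := apply_eq_zero_of_mem_wordKer h
    rw [coordMulTest_apply] at this
    exact (mul_eq_zero.1 this).resolve_right ha
  induction k generalizing φ with
  | zero => exact h0
  | succ k ih =>
    have hk := ih (mem_wordKer_of_mem_succ h) h0
    refine ⟨h0, fun i => ?_⟩
    have h1 : coordMulTest Ω j (partialTest Ω i φ) ∈ wordKer (partialTest Ω) a k := by
      have := add_mem_wordKer (h.2 i)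
        (smul_mem_wordKer (-(Pi.single i (1 : ℝ) : Fin d → ℝ) j) hk)
      rwa [partialTest_coordMulTest, add_assoc, ← add_smul, add_neg_cancel, zero_smul,
        add_zero] at this
    refine ih h1 ?_
    have := apply_eq_zero_of_mem_wordKer h1
    rw [coordMulTest_apply] at this
    exact (mul_eq_zero.1 this).resolve_right ha

/-- The transpose of `θ_j` is `-(x_j ∂_j + 1)`, so `x_j ∂_j φ` is a combination of `thetaTest Ω j φ`
and `φ`; then `x_j` is divided out. -/
theorem mem_wordKer_partialTest_of_mem_wordKer_thetaTest {a : Fin d → ℝ} (ha : ∀ j, a j ≠ 0)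
    {k : ℕ} {φ : 𝓓(Ω, ℝ)} (h : φ ∈ wordKer (thetaTest Ω) a k) :
    φ ∈ wordKer (partialTest Ω) a k := by
  induction k generalizing φ with
  | zero => exact h
  | succ k ih =>
    refine ⟨h.1, fun j => mem_wordKer_of_coordMulTest_mem (ha j) ?_⟩
    have h1 := add_mem_wordKer (smul_mem_wordKer (-1) (ih (h.2 j)))
      (smul_mem_wordKer (-1) (ih (mem_wordKer_of_mem_succ h)))
    rw [thetaTest_apply_eq] at h1
    simpa using h1

/-- Linearity in the last argument reduces it to a basis vector, which trades one order of the jet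
for one partial derivative of `φ`. -/
theorem iteratedFDeriv_eq_zero_of_mem_wordKer {a : Fin d → ℝ} {k : ℕ} {φ : 𝓓(Ω, ℝ)}
    (h : φ ∈ wordKer (partialTest Ω) a k) {i : ℕ} (hi : i ≤ k) : iteratedFDeriv ℝ i φ a = 0 := by
  induction i generalizing k φ with
  | zero =>
    ext m
    simpa using apply_eq_zero_of_mem_wordKer h
  | succ i ih =>
    obtain ⟨k, rfl⟩ : ∃ l, k = l + 1 := ⟨k - 1, by omega⟩
    ext m
    rw [iteratedFDeriv_succ_apply_right, zero_apply]
    have hlin : iteratedFDeriv ℝ i (fun y => fderiv ℝ φ y) a (Fin.init m) = 0 := by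
      refine ContinuousLinearMap.coe_injective ((Pi.basisFun ℝ (Fin d)).ext fun j => ?_)
      have hc : ContDiffAt ℝ ∞ (fderiv ℝ φ) a :=
        (φ.contDiff.fderiv_right (m := ∞) (by simp)).contDiffAt
      have h1 := (ContinuousLinearMap.apply ℝ ℝ (Pi.single j 1 : Fin d → ℝ)).iteratedFDeriv_comp_left
        hc (i := i) (by exact_mod_cast le_top)
      have h2 : (ContinuousLinearMap.apply ℝ ℝ (Pi.single j 1 : Fin d → ℝ)) ∘ fderiv ℝ φ =
          partialTest Ω j φ := funext fun y => (partialTest_apply j φ y).symm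
      rw [h2, ih (h.2 j) (by omega)] at h1
      have h3 := congr($h1 (Fin.init m))
      simpa using h3.symm
    rw [hlin, zero_apply]

/-- The composition `A_d^{α_d} ∘ ⋯ ∘ A_1^{α_1}` of the transposes of the operators `θ_j`. -/
def thetaTestPow (Ω : Opens (Fin d → ℝ)) (α : Fin d →₀ ℕ) : 𝓓(Ω, ℝ) →L[ℝ] 𝓓(Ω, ℝ) :=
  (List.ofFn fun j => thetaTest Ω j ^ α j).reverse.prod

theorem thetaTestPow_add_single (α : Fin d →₀ ℕ) (j : Fin d) :
    thetaTestPow Ω (α + Finsupp.single j 1) = thetaTestPow Ω α * thetaTest Ω j := by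
  -- The generated subalgebra is commutative; there the ordered list product becomes a `Finset`
  -- product that can be rearranged.
  let R := Algebra.adjoin ℝ (range (thetaTest Ω))
  have : IsMulCommutative R := Algebra.isMulCommutative_adjoin ℝ (by
    rintro _ ⟨i, rfl⟩ _ ⟨j, rfl⟩
    exact commute_thetaTest i j)
  let : CommRing R := IsMulCommutative.instCommRing
  let t : Fin d → R := fun j => ⟨thetaTest Ω j, Algebra.subset_adjoin (mem_range_self j)⟩
  have h : ∀ β : Fin d →₀ ℕ, thetaTestPow Ω β = R.val (∏ j, t j ^ β j) := by
    intro β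
    rw [← List.prod_ofFn, ← (List.reverse_perm _).prod_eq, map_list_prod, List.map_reverse,
      List.map_ofFn]
    rfl
  have ht : thetaTest Ω j = R.val (t j) := rfl
  rw [h, h, ht, ← map_mul]
  congr 1
  simp only [Finsupp.add_apply, pow_add, Finset.prod_mul_distrib]
  congr 1
  rw [Finset.prod_eq_single j]
  · simp
  · intro i _ hij
    simp [Finsupp.single_eq_of_ne hij]
  · simp

theorem thetaTestPow_zero : thetaTestPow Ω 0 = 1 := by
  simp [thetaTestPow]

/-- The transposes commute, so every word of length at most `k` in them is a `thetaTestPow` of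
degree at most `k`. -/
theorem mem_wordKer_thetaTest {a : Fin d → ℝ} {k : ℕ} {φ : 𝓓(Ω, ℝ)}
    (h : ∀ α : Fin d →₀ ℕ, α.degree ≤ k → thetaTestPow Ω α φ a = 0) :
    φ ∈ wordKer (thetaTest Ω) a k := by
  have h0 : φ a = 0 := by simpa [thetaTestPow_zero] using h 0 (by simp)
  induction k generalizing φ with
  | zero => exact h0
  | succ k ih =>
    refine ⟨h0, fun j => ?_⟩
    have h1 : ∀ α : Fin d →₀ ℕ, α.degree ≤ k → thetaTestPow Ω α (thetaTest Ω j φ) a = 0 := by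
      intro α hα
      have := h (α + Finsupp.single j 1) (by simpa using hα)
      rwa [thetaTestPow_add_single] at this
    exact ih h1 (by simpa [thetaTestPow_zero] using h1 0 (by simp))

variable {𝕜 : Type*} [RCLike 𝕜]

theorem theta_apply_eq (j : Fin d) (S : 𝓓'(Ω, 𝕜)) (φ : 𝓓(Ω, ℝ)) :
    theta 𝕜 Ω j S φ = S (thetaTest Ω j φ) := by
  rw [theta_apply]
  exact (map_neg S _).symm

/-- Transposition reverses compositions, which accounts for the `reverse` in `thetaTestPow`. -/
theorem thetaPow_apply (α : Fin d →₀ ℕ) (S : 𝓓'(Ω, 𝕜)) (φ : 𝓓(Ω, ℝ)) :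
    thetaPow 𝕜 Ω α S φ = S (thetaTestPow Ω α φ) := by
  have hpow : ∀ (j : Fin d) (n : ℕ) (S : 𝓓'(Ω, 𝕜)) (φ : 𝓓(Ω, ℝ)),
      (theta 𝕜 Ω j ^ n) S φ = S ((thetaTest Ω j ^ n) φ) := by
    intro j n
    induction n with
    | zero => intro S φ; rfl
    | succ n ih =>
      intro S φ
      rw [pow_succ, pow_succ']
      change (theta 𝕜 Ω j ^ n) (theta 𝕜 Ω j S) φ = S (thetaTest Ω j ((thetaTest Ω j ^ n) φ))
      rw [ih, theta_apply_eq]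
  have hlist : ∀ (l : List (Fin d)) (S : 𝓓'(Ω, 𝕜)) (φ : 𝓓(Ω, ℝ)),
      (l.map fun j => theta 𝕜 Ω j ^ α j).prod S φ =
        S ((l.map fun j => thetaTest Ω j ^ α j).reverse.prod φ) := by
    intro l
    induction l with
    | nil => intro S φ; rfl
    | cons j l ih =>
      intro S φ
      rw [List.map_cons, List.prod_cons, List.map_cons, List.reverse_cons, List.prod_append,
        List.prod_singleton]
      change (theta 𝕜 Ω j ^ α j) ((l.map fun j => theta 𝕜 Ω j ^ α j).prod S) φ =
        S ((l.map fun j => thetaTest Ω j ^ α j).reverse.prod ((thetaTest Ω j ^ α j) φ))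
      rw [hpow, ih]
  rw [thetaPow, thetaTestPow, List.ofFn_eq_map, List.ofFn_eq_map]
  exact hlist _ S φ

/-- `thetaTestPow` inherits from the operators `thetaTest` every property that is stable under
composition. -/
theorem thetaTestPow_induction {p : (𝓓(Ω, ℝ) →L[ℝ] 𝓓(Ω, ℝ)) → Prop} (one : p 1)
    (mul : ∀ A B, p A → p B → p (A * B)) (theta : ∀ j, p (thetaTest Ω j)) (α : Fin d →₀ ℕ) :
    p (thetaTestPow Ω α) := by
  have hpow : ∀ (j : Fin d) (n : ℕ), p (thetaTest Ω j ^ n) := by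
    intro j n
    induction n with
    | zero => simpa using one
    | succ n ih =>
      rw [pow_succ]
      exact mul _ _ ih (theta j)
  have hlist : ∀ l : List (𝓓(Ω, ℝ) →L[ℝ] 𝓓(Ω, ℝ)), (∀ A ∈ l, p A) → p l.prod := by
    intro l
    induction l with
    | nil => exact fun _ => one
    | cons A l ih =>
      intro h
      rw [List.prod_cons]
      exact mul _ _ (h A List.mem_cons_self) (ih fun B hB => h B (List.mem_cons_of_mem A hB))
  refine hlist _ fun A hA => ?_
  obtain ⟨j, rfl⟩ := List.mem_ofFn.1 (List.mem_reverse.1 hA)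
  exact hpow j _

end Hadamard

/-! ### Identification of the transpose with a polynomial in the transposed `θ_j`. -/

namespace Hadamard

variable {d : ℕ} {Ω : Opens (Fin d → ℝ)}

theorem thetaTest_apply_apply (j : Fin d) (φ : 𝓓(Ω, ℝ)) (x : Fin d → ℝ) :
    thetaTest Ω j φ x = -(fderiv ℝ φ x (Pi.single j 1) * x j + φ x) := by
  rw [thetaTest_apply_eq, ← partialTest_apply]
  rfl

/-- The factor `η j` that the chain rule produces is absorbed by the coordinate `x j`. -/
theorem thetaTestPow_comp_dilation {η : Fin d → ℝˣ} {φ χ : 𝓓(Ω, ℝ)}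
    (h : ∀ x, χ x = φ (dilation η x)) (α : Fin d →₀ ℕ) (x : Fin d → ℝ) :
    thetaTestPow Ω α χ x = thetaTestPow Ω α φ (dilation η x) := by
  suffices H : ∀ φ χ : 𝓓(Ω, ℝ), (∀ x, χ x = φ (dilation η x)) →
      ∀ x, thetaTestPow Ω α χ x = thetaTestPow Ω α φ (dilation η x) from H φ χ h x
  refine thetaTestPow_induction (p := fun B => ∀ φ χ : 𝓓(Ω, ℝ),
    (∀ x, χ x = φ (dilation η x)) → ∀ x, B χ x = B φ (dilation η x)) (fun φ χ h => h)
    (fun A B hA hB φ χ h => hA _ _ (hB _ _ h)) (fun j φ χ h x => ?_) α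
  have hχ : (χ : (Fin d → ℝ) → ℝ) = φ ∘ dilation η := funext h
  have hD : dilation η (Pi.single j 1) = (η j : ℝ) • (Pi.single j 1 : Fin d → ℝ) := by
    ext i
    rcases eq_or_ne i j with rfl | hij
    · simp [dilation_apply]
    · simp [dilation_apply, Pi.single_eq_of_ne hij]
  rw [thetaTest_apply_apply, thetaTest_apply_apply, h, hχ,
    (dilation η).comp_right_fderiv, dilation_apply]
  change -(fderiv ℝ φ (dilation η x) (dilation η (Pi.single j 1)) * x j + _) = _
  rw [hD, map_smul, smul_eq_mul]
  ring

theorem thetaTestPow_apply_eq_zero_of_notMem_tsupport {φ : 𝓓(Ω, ℝ)} {x : Fin d → ℝ}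
    (h : x ∉ tsupport φ) (α : Fin d →₀ ℕ) : thetaTestPow Ω α φ x = 0 := by
  -- Vanishing near `x`, unlike vanishing at `x`, is preserved by each operator and hence by
  -- compositions.
  suffices H : ∀ φ : 𝓓(Ω, ℝ), (φ : (Fin d → ℝ) → ℝ) =ᶠ[𝓝 x] 0 →
      (thetaTestPow Ω α φ : (Fin d → ℝ) → ℝ) =ᶠ[𝓝 x] 0 from
    (H φ (notMem_tsupport_iff_eventuallyEq.1 h)).eq_of_nhds
  refine thetaTestPow_induction (p := fun B => ∀ φ : 𝓓(Ω, ℝ),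
    (φ : (Fin d → ℝ) → ℝ) =ᶠ[𝓝 x] 0 → (B φ : (Fin d → ℝ) → ℝ) =ᶠ[𝓝 x] 0) (fun φ h => h)
    (fun A B hA hB φ h => hA _ (hB _ h)) (fun j φ h => ?_) α
  filter_upwards [h, h.fderiv (𝕜 := ℝ)] with y hy hy'
  rw [thetaTest_apply_apply, hy, hy']
  simp

variable {𝕜 : Type*} [RCLike 𝕜]

/-- A linear form vanishing on the common kernel of finitely many others lies in their span; this is
applied to the real and imaginary parts of `T`. -/
theorem exists_coeff_forall_apply_eq_sum (T : 𝓓'(Ω, 𝕜)) {a : Fin d → ℝ} (s : Finset (Fin d →₀ ℕ))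
    (h : ∀ φ : 𝓓(Ω, ℝ), (∀ α ∈ s, thetaTestPow Ω α φ a = 0) → T φ = 0) :
    ∃ c : (Fin d →₀ ℕ) → 𝕜, ∀ φ, T φ = ∑ α ∈ s, c α * ((thetaTestPow Ω α φ a : ℝ) : 𝕜) := by
  let ℓ : s → 𝓓(Ω, ℝ) →ₗ[ℝ] ℝ := fun α =>
    { toFun := fun φ => thetaTestPow Ω α φ a
      map_add' := fun φ χ => by rw [map_add]; rfl
      map_smul' := fun r φ => by rw [map_smul]; rfl }
  have key : ∀ A : 𝕜 →ₗ[ℝ] ℝ, ∃ c : s → ℝ, ∀ φ, A (T φ) = ∑ α, c α * thetaTestPow Ω α φ a := by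
    intro A
    have hker : ⨅ α, (ℓ α).ker ≤
        (A ∘ₗ (T : 𝓓(Ω, ℝ) →L[ℝ] 𝕜).toLinearMap).ker := by
      intro φ hφ
      rw [Submodule.mem_iInf] at hφ
      have := h φ fun α hα => hφ ⟨α, hα⟩
      change A (T φ) = 0
      rw [this, map_zero]
    obtain ⟨c, hc⟩ :=
      (Submodule.mem_span_range_iff_exists_fun ℝ).1 (mem_span_of_iInf_ker_le_ker hker)
    refine ⟨c, fun φ => ?_⟩
    have := congr($hc φ)
    rw [LinearMap.sum_apply] at this
    exact this.symm
  obtain ⟨c₁, h₁⟩ := key RCLike.reLm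
  obtain ⟨c₂, h₂⟩ := key RCLike.imLm
  refine ⟨fun α => if hα : α ∈ s then (c₁ ⟨α, hα⟩ : 𝕜) + c₂ ⟨α, hα⟩ * RCLike.I else 0,
    fun φ => ?_⟩
  rw [← RCLike.re_add_im (T φ), ← Finset.sum_coe_sort s]
  have e₁ : RCLike.re (T φ) = _ := h₁ φ
  have e₂ : RCLike.im (T φ) = _ := h₂ φ
  rw [e₁, e₂, RCLike.ofReal_sum, RCLike.ofReal_sum, Finset.sum_mul, ← Finset.sum_add_distrib]
  refine Finset.sum_congr rfl fun α _ => ?_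
  simp only [α.2, dif_pos]
  push_cast
  ring

variable {L : 𝓓'(Ω, 𝕜) →L[𝕜] 𝓓'(Ω, 𝕜)}

/-- By locality `L δ_a` is supported at `a`, so it sees only a `k`-jet, and the `thetaTestPow` of
degree at most `k` determine when that jet vanishes. -/
theorem IsHadamardOperator.exists_coeff_transpose_eq_sum (hL : IsHadamardOperator L)
    (hΩ : RelativelyCompactIn (Ω : Set (Fin d → ℝ)) (posOrthant d)) {a : Fin d → ℝ} (ha : a ∈ Ω) :
    ∃ (s : Finset (Fin d →₀ ℕ)) (c : (Fin d →₀ ℕ) → 𝕜), ∀ φ,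
      transpose L φ a = ∑ α ∈ s, c α * ((thetaTestPow Ω α φ a : ℝ) : 𝕜) := by
  have hpos : ∀ j, 0 < a j := hΩ.2 (subset_closure ha)
  obtain ⟨k, hk⟩ := exists_forall_jet_eq_zero_imp_eq_zero
    (L (Distribution.ofRealCLM (Distribution.delta a))) ha
    fun φ hφ => hL.transpose_eq_zero_of_notMem_tsupport hΩ φ hφ
  refine ⟨(Finsupp.finite_of_degree_le k).toFinset,
    exists_coeff_forall_apply_eq_sum _ _ fun φ hφ => hk φ fun i hi => ?_⟩
  refine iteratedFDeriv_eq_zero_of_mem_wordKer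
    (mem_wordKer_partialTest_of_mem_wordKer_thetaTest (fun j => (hpos j).ne')
      (mem_wordKer_thetaTest fun α hα => hφ α ?_)) hi
  simpa using hα

/-- The dilation taking `a` to `x` transports the formula, as both sides commute with dilations. -/
theorem IsHadamardOperator.transpose_eq_sum (hL : IsHadamardOperator L)
    (hΩ : RelativelyCompactIn (Ω : Set (Fin d → ℝ)) (posOrthant d)) {a : Fin d → ℝ} (ha : a ∈ Ω)
    {s : Finset (Fin d →₀ ℕ)} {c : (Fin d →₀ ℕ) → 𝕜}
    (h : ∀ φ, transpose L φ a = ∑ α ∈ s, c α * ((thetaTestPow Ω α φ a : ℝ) : 𝕜))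
    (φ : 𝓓(Ω, ℝ)) (x : Fin d → ℝ) :
    transpose L φ x = ∑ α ∈ s, c α * ((thetaTestPow Ω α φ x : ℝ) : 𝕜) := by
  by_cases hx : x ∈ Ω
  swap
  · rw [transpose_eq_zero_of_notMem L φ hx]
    refine (Finset.sum_eq_zero fun α _ => ?_).symm
    rw [thetaTestPow_apply_eq_zero_of_notMem_tsupport (fun h => hx (φ.tsupport_subset h)),
      RCLike.ofReal_zero, mul_zero]
  have hpos : ∀ z ∈ Ω, ∀ j, 0 < z j := fun z hz => hΩ.2 (subset_closure hz)
  let η : Fin d → ℝˣ := fun j => Units.mk0 (x j / a j) (div_pos (hpos x hx j) (hpos a ha j)).ne'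
  have hη : dilation η a = x := by
    ext j
    rw [dilation_apply]
    exact mul_div_cancel₀ _ (hpos a ha j).ne'
  have hη' : dilation η⁻¹ x = a := by rw [← hη, dilation_inv_dilation]
  have hU : (dilation η⁻¹) ⁻¹' (Ω : Set (Fin d → ℝ)) ∈ 𝓝 x :=
    (dilation η⁻¹).continuous.continuousAt.preimage_mem_nhds
      (by rw [hη']; exact Ω.isOpen.mem_nhds ha)
  obtain ⟨ε, hε, hball⟩ := Metric.nhds_basis_closedBall.mem_iff.1 hU
  -- The dilate of `φ` itself may leave `Ω`; by locality of both sides, `φ` may first be cut off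
  -- near `x`.
  let g : ContDiffBump x := ⟨ε / 2, ε, half_pos hε, half_lt_self hε⟩
  have hg : ContDiff ℝ ∞ g := g.contDiff
  obtain ⟨χ, hχ⟩ := exists_testFunction_comp_dilation η (mulTest hg φ) fun y hy => by
    have : y ∈ tsupport g := tsupport_mul_subset_left hy
    rw [g.tsupport_eq] at this
    exact hball this
  have hloc : x ∉ tsupport (φ - mulTest hg φ : 𝓓(Ω, ℝ)) := by
    rw [notMem_tsupport_iff_eventuallyEq]
    filter_upwards [g.eventuallyEq_one] with y hy
    change φ y - g y * φ y = 0
    rw [hy, Pi.one_apply, one_mul, sub_self]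
  have h1 : transpose L φ x = transpose L (mulTest hg φ) x := by
    have := hL.transpose_eq_zero_of_notMem_tsupport hΩ _ hloc
    rw [transpose, map_sub] at this
    exact sub_eq_zero.1 this
  have h2 : ∀ α, thetaTestPow Ω α φ x = thetaTestPow Ω α (mulTest hg φ) x := by
    intro α
    have := thetaTestPow_apply_eq_zero_of_notMem_tsupport hloc α
    rw [map_sub] at this
    exact sub_eq_zero.1 this
  have h3 := hL.transpose_comp_dilation hχ a
  rw [hη] at h3
  rw [h1, ← h3, h]
  refine Finset.sum_congr rfl fun α _ => ?_
  rw [h2, thetaTestPow_comp_dilation hχ, hη]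

theorem apply_eq_sum_of_transpose_eq_sum {s : Finset (Fin d →₀ ℕ)} {c : (Fin d →₀ ℕ) → 𝕜}
    {φ : 𝓓(Ω, ℝ)}
    (h : ∀ x, transpose L φ x = ∑ α ∈ s, c α * ((thetaTestPow Ω α φ x : ℝ) : 𝕜))
    (S : 𝓓'(Ω, 𝕜)) : L S φ = ∑ α ∈ s, c α * S (thetaTestPow Ω α φ) := by
  obtain ⟨ψ₁, ψ₂, hS, hψ⟩ := exists_transpose_eq L φ
  have hsum : ∀ b : (Fin d →₀ ℕ) → ℝ,
      S (∑ α ∈ s, b α • thetaTestPow Ω α φ) = ∑ α ∈ s, (b α : 𝕜) * S (thetaTestPow Ω α φ) := by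
    intro b
    rw [map_sum]
    refine Finset.sum_congr rfl fun α _ => ?_
    rw [map_smul, RCLike.real_smul_eq_coe_mul]
  have hval : ∀ (b : (Fin d →₀ ℕ) → ℝ) (x : Fin d → ℝ),
      (∑ α ∈ s, b α • thetaTestPow Ω α φ : 𝓓(Ω, ℝ)) x =
        ∑ α ∈ s, b α * thetaTestPow Ω α φ x := by
    intro b x
    rw [sum_apply]
    rfl
  have hre : ψ₁ = ∑ α ∈ s, RCLike.re (c α) • thetaTestPow Ω α φ := by
    ext x
    have := congrArg RCLike.re ((hψ x).symm.trans (h x))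
    rw [hval]
    simpa [map_sum] using this
  rw [hS, hre, hsum]
  -- Over `ℝ` the function `ψ₂` is not determined by the transpose, but it enters only with the
  -- factor `I = 0`.
  rcases RCLike.I_eq_zero_or_im_I_eq_one (K := 𝕜) with hI | hI
  · rw [hI, zero_mul, add_zero]
    refine Finset.sum_congr rfl fun α _ => ?_
    conv_rhs => rw [← RCLike.re_add_im (c α), hI, mul_zero, add_zero]
  · have him : ψ₂ = ∑ α ∈ s, RCLike.im (c α) • thetaTestPow Ω α φ := by
      ext x
      have := congrArg RCLike.im ((hψ x).symm.trans (h x))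
      rw [hval]
      simpa [map_sum, hI] using this
    rw [him, hsum, Finset.mul_sum, ← Finset.sum_add_distrib]
    refine Finset.sum_congr rfl fun α _ => ?_
    conv_rhs => rw [← RCLike.re_add_im (c α)]
    ring

theorem polyTheta_sum_monomial_apply (s : Finset (Fin d →₀ ℕ)) (c : (Fin d →₀ ℕ) → 𝕜)
    (S : 𝓓'(Ω, 𝕜)) (φ : 𝓓(Ω, ℝ)) :
    polyTheta Ω (∑ α ∈ s, MvPolynomial.monomial α (c α)) S φ =
      ∑ α ∈ s, c α * S (thetaTestPow Ω α φ) := by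
  classical
  have hcoeff : ∀ β, MvPolynomial.coeff β (∑ α ∈ s, MvPolynomial.monomial α (c α)) =
      if β ∈ s then c β else 0 := by
    intro β
    simp [MvPolynomial.coeff_sum, MvPolynomial.coeff_monomial]
  have hsub : (∑ α ∈ s, MvPolynomial.monomial α (c α)).support ⊆ s := by
    intro β hβ
    rw [MvPolynomial.mem_support_iff, hcoeff] at hβ
    by_contra hs
    exact hβ (if_neg hs)
  -- Some `c α` may be zero, so the support of the polynomial may be smaller than `s`; the extra
  -- terms vanish.
  rw [polyTheta, Finset.sum_subset hsub fun β _ hβ => by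
    rw [MvPolynomial.notMem_support_iff.1 hβ, zero_smul]]
  have e : ∀ A : (Fin d →₀ ℕ) → 𝓓'(Ω, 𝕜) →L[𝕜] 𝓓'(Ω, 𝕜),
      (∑ α ∈ s, A α) S φ = ∑ α ∈ s, A α S φ := by
    intro A
    rw [sum_apply, sum_apply]
  rw [e]
  refine Finset.sum_congr rfl fun α hα => ?_
  rw [hcoeff, if_pos hα, ← thetaPow_apply]
  rfl

end Hadamard

end

theorem theorem3p7 {𝕜 : Type*} [RCLike 𝕜] {d : ℕ} (Ω : TopologicalSpace.Opens (Fin d → ℝ))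
    (hne : (Ω : Set (Fin d → ℝ)).Nonempty)
    (hΩ : Hadamard.RelativelyCompactIn (Ω : Set (Fin d → ℝ)) (Hadamard.posOrthant d))
    (L : 𝓓'(Ω, 𝕜) →L[𝕜] 𝓓'(Ω, 𝕜)) (hL : Hadamard.IsHadamardOperator L) :
    Hadamard.IsEulerOperator L := by
  obtain ⟨a, ha⟩ := hne
  obtain ⟨s, c, hc⟩ := hL.exists_coeff_transpose_eq_sum hΩ ha
  refine ⟨∑ α ∈ s, MvPolynomial.monomial α (c α), ?_⟩
  ext S φ
  rw [Hadamard.polyTheta_sum_monomial_apply,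
    Hadamard.apply_eq_sum_of_transpose_eq_sum (hL.transpose_eq_sum hΩ ha hc φ)]
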